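/- Let $(M,\rho)$ be a compact connected hyperbolic manifold of dimension $d\ge 0$, with empty or locally convex (for instance totally geodesic) boundary: $\rho$ is a length metric, and every point of $M$ is the centre of a small ball isometric to the ball of the same radius about a point of a closed convex subset with nonempty interior of the hyperbolic space $\mathbf H^d$. Let $x_0\in M$, put $\pi_1(M)=\pi_1(M,x_0)$, and let $\mathcal S$ be a finite generating set of $\pi_1(M)$, with word length $\|\cdot\|_{\mathcal S}$ (with respect to $\mathcal S\cup\mathcal S^{-1}$). For a group $G$ and $g\in G\setminus\{1\}$ put $$D_G(g)=\min\{[G:H] : H\le G,\ g\notin H\}\in\mathbf N\cup\{\infty\}.$$ For $\alpha\in\pi_1(M)\setminus\{1\}$ let $\ell_\rho(\alpha)$ be the length of the geodesic representative of $\alpha$, that is, of the closed geodesic in the free homotopy class of $\alpha$. For $n\in\mathbf N$ define $$\mathrm{DM}_{\pi_1(M),\mathcal S}(n)=\max\{D_{\pi_1(M)}(\alpha) : \alpha\in\pi_1(M)\setminus\{1\},\ \|\alpha\|_{\mathcal S}\le n\},$$ $$\mathrm{DM}_{M,\rho}(n)=\max\{D_{\pi_1(M)}(\alpha) : \alpha\in\pi_1(M)\setminus\{1\},\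 \ell_\rho(\alpha)\le n\},$$ where the maximum over the empty set is $0$. For functions $f,g$ on $\mathbf N$ write $f\preceq g$ if there is an integer $C>0$ such that $f(n)\le C\,g(Cn)$ for all $n\in\mathbf N$, and $f\simeq g$ if $f\preceq g$ and $g\preceq f$. Then $$\mathrm{DM}_{\pi_1(M),\mathcal S}\simeq \mathrm{DM}_{M,\rho}.$$ -/

import Mathlib

noncomputable section

/-! ### Hyperbolic space -/

/-- Real hyperbolic `n`-space `𝐇ⁿ` (hyperboloid model): the upper sheet of the hyperboloid
`time ^ 2 - ‖space‖ ^ 2 = 1` in Minkowski space `ℝ × ℝⁿ`. -/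
@[ext]
structure HypSpace (n : ℕ) where
  /-- the time-like coordinate -/
  time : ℝ
  /-- the space-like coordinates -/
  space : EuclideanSpace ℝ (Fin n)
  time_pos : 0 < time
  time_sq : time ^ 2 = 1 + ‖space‖ ^ 2

namespace HypSpace

variable {n : ℕ}

/-- Minus the Minkowski product, i.e. the hyperbolic cosine of the hyperbolic distance. -/
def coshDist (x y : HypSpace n) : ℝ := x.time * y.time - inner ℝ x.space y.space

theorem coshDist_comm (x y : HypSpace n) : coshDist x y = coshDist y x := by
  unfold coshDist
  rw [mul_comm, real_inner_comm]

theorem coshDist_self (x : HypSpace n) : coshDist x x = 1 := by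
  unfold coshDist
  rw [real_inner_self_eq_norm_sq]
  linarith [x.time_sq]

theorem one_le_coshDist (x y : HypSpace n) : 1 ≤ coshDist x y := by
  unfold coshDist
  have h1 := real_inner_le_norm x.space y.space
  have h2 : 1 + ‖x.space‖ * ‖y.space‖ ≤ x.time * y.time := by
    have hp := mul_pos x.time_pos y.time_pos
    refine (sq_le_sq₀ (by positivity) hp.le).1 ?_
    rw [mul_pow x.time, x.time_sq, y.time_sq]
    nlinarith [sq_nonneg (‖x.space‖ - ‖y.space‖)]
  linarith

theorem eq_of_coshDist_eq_one {x y : HypSpace n} (h : coshDist x y = 1) : x = y := by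
  unfold coshDist at h
  have h1 : (inner ℝ x.space y.space) ^ 2 ≤ ‖x.space‖ ^ 2 * ‖y.space‖ ^ 2 := by
    rw [← mul_pow]
    exact sq_le_sq' (by linarith [neg_le_of_abs_le (abs_real_inner_le_norm x.space y.space)])
      (real_inner_le_norm _ _)
  have h2 : (x.time * y.time) ^ 2 = (1 + inner ℝ x.space y.space) ^ 2 := by
    congr 1; linarith
  rw [mul_pow, x.time_sq, y.time_sq] at h2
  have h3 : ‖x.space - y.space‖ ^ 2 ≤ 0 := by
    rw [norm_sub_sq_real]
    nlinarith
  have h4 : x.space = y.space := by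
    rw [← sub_eq_zero, ← norm_eq_zero]
    exact pow_eq_zero_iff two_ne_zero |>.1 (le_antisymm h3 (sq_nonneg _))
  refine HypSpace.ext ?_ h4
  have h5 : x.time ^ 2 = y.time ^ 2 := by rw [x.time_sq, y.time_sq, h4]
  exact (sq_eq_sq₀ x.time_pos.le y.time_pos.le).1 h5

/-- The Minkowski form is positive semidefinite on the orthogonal complement of a point. -/
theorem sq_le_of_orthogonal (y : HypSpace n) {s : ℝ} {p : EuclideanSpace ℝ (Fin n)}
    (h : s * y.time = inner ℝ p y.space) : s ^ 2 ≤ ‖p‖ ^ 2 := by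
  have h1 : (inner ℝ p y.space) ^ 2 ≤ ‖p‖ ^ 2 * ‖y.space‖ ^ 2 := by
    rw [← mul_pow]
    exact sq_le_sq' (by linarith [neg_le_of_abs_le (abs_real_inner_le_norm p y.space)])
      (real_inner_le_norm _ _)
  rw [← h, mul_pow, y.time_sq] at h1
  by_contra! hlt
  nlinarith [sq_nonneg s, mul_nonneg (sub_nonneg.2 hlt.le) (sq_nonneg ‖y.space‖), sq_nonneg ‖p‖]

/-- The resulting Cauchy–Schwarz inequality. -/
theorem cauchySchwarz_of_orthogonal (y : HypSpace n) {s t : ℝ} {p q : EuclideanSpace ℝ (Fin n)}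
    (hs : s * y.time = inner ℝ p y.space) (ht : t * y.time = inner ℝ q y.space) :
    (inner ℝ p q - s * t) ^ 2 ≤ (‖p‖ ^ 2 - s ^ 2) * (‖q‖ ^ 2 - t ^ 2) := by
  have key : ∀ k : ℝ, 0 ≤ (‖q‖ ^ 2 - t ^ 2) * (k * k) + (2 * (inner ℝ p q - s * t)) * k
      + (‖p‖ ^ 2 - s ^ 2) := by
    intro k
    have h := sq_le_of_orthogonal y (s := s + k * t) (p := p + k • q) (by
      rw [inner_add_left, real_inner_smul_left, ← hs, ← ht]; ring)
    rw [norm_add_sq_real, norm_smul, real_inner_smul_right, mul_pow, Real.norm_eq_abs,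
      sq_abs] at h
    nlinarith
  have h := discrim_le_zero key
  unfold discrim at h
  nlinarith

theorem coshDist_triangle (x y z : HypSpace n) :
    (coshDist x z - coshDist x y * coshDist y z) ^ 2
      ≤ (coshDist x y ^ 2 - 1) * (coshDist y z ^ 2 - 1) := by
  have h := cauchySchwarz_of_orthogonal y
    (s := x.time - coshDist x y * y.time) (t := z.time - coshDist y z * y.time)
    (p := x.space - coshDist x y • y.space) (q := z.space - coshDist y z • y.space)
    (by
      have hy := y.time_sq
      rw [inner_sub_left, real_inner_smul_left, real_inner_self_eq_norm_sq]
      unfold coshDist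
      linear_combination (-(x.time * y.time - inner ℝ x.space y.space)) * hy)
    (by
      have hy := y.time_sq
      rw [inner_sub_left, real_inner_smul_left, real_inner_self_eq_norm_sq]
      unfold coshDist
      rw [real_inner_comm z.space y.space]
      linear_combination (-(y.time * z.time - inner ℝ z.space y.space)) * hy)
  have hx := x.time_sq
  have hy := y.time_sq
  have hz := z.time_sq
  rw [norm_sub_sq_real, norm_sub_sq_real, norm_smul, norm_smul, mul_pow, mul_pow,
    Real.norm_eq_abs, Real.norm_eq_abs, sq_abs, sq_abs, inner_sub_left, inner_sub_right,
    inner_sub_right, real_inner_smul_left, real_inner_smul_left, real_inner_smul_right,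
    real_inner_smul_right, real_inner_smul_right, real_inner_smul_right,
    real_inner_self_eq_norm_sq] at h
  have e1 : (inner ℝ x.space y.space : ℝ) = x.time * y.time - coshDist x y := by
    unfold coshDist; ring
  have e2 : (inner ℝ y.space z.space : ℝ) = y.time * z.time - coshDist y z := by
    unfold coshDist; ring
  have e2' : (inner ℝ z.space y.space : ℝ) = y.time * z.time - coshDist y z := by
    rw [real_inner_comm, e2]
  have e3 : (inner ℝ x.space z.space : ℝ) = x.time * z.time - coshDist x z := by
    unfold coshDist; ring
  have nx : ‖x.space‖ ^ 2 = x.time ^ 2 - 1 := by linarith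
  have ny : ‖y.space‖ ^ 2 = y.time ^ 2 - 1 := by linarith
  have nz : ‖z.space‖ ^ 2 = z.time ^ 2 - 1 := by linarith
  rw [e1, e2, e2', e3, nx, ny, nz] at h
  ring_nf at h ⊢
  linarith

/-- The hyperbolic metric, `cosh d(x, y) = x₀ y₀ - ⟨x', y'⟩`. -/
instance : MetricSpace (HypSpace n) where
  dist x y := Real.arcosh (coshDist x y)
  dist_self x := by
    rw [coshDist_self, Real.arcosh_zero]
  dist_comm x y := by
    rw [coshDist_comm]
  dist_triangle x y z := by
    have h1 := one_le_coshDist x y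
    have h2 := one_le_coshDist y z
    have hs := add_nonneg (Real.arcosh_nonneg h1) (Real.arcosh_nonneg h2)
    rw [← Real.arcosh_cosh hs, Real.arcosh_le_arcosh (by linarith [one_le_coshDist x z])
      (Real.cosh_pos _), Real.cosh_add, Real.cosh_arcosh h1, Real.cosh_arcosh h2,
      Real.sinh_arcosh h1, Real.sinh_arcosh h2, ← Real.sqrt_mul (by nlinarith)]
    have := Real.le_sqrt_of_sq_le (coshDist_triangle x y z)
    linarith
  eq_of_dist_eq_zero {x y} h :=
    eq_of_coshDist_eq_one ((Real.arcosh_eq_zero_iff (one_le_coshDist x y)).1 h)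

theorem dist_def (x y : HypSpace n) :
    dist x y = Real.arcosh (x.time * y.time - inner ℝ x.space y.space) := rfl

end HypSpace

/-- A set `K` is (geodesically) convex if it contains every point lying metrically between two of
its points. In `𝐇ⁿ` these are the points of the geodesic segments joining points of `K`. -/
def GeodesicallyConvex {X : Type*} [MetricSpace X] (K : Set X) : Prop :=
  ∀ x ∈ K, ∀ y ∈ K, ∀ z : X, dist x z + dist z y = dist x y → z ∈ K

/-! ### Hyperbolic manifolds and closed geodesics -/

/-- The metric space `M` is a (connected) hyperbolic `n`-manifold with (possibly empty) locally
convex boundary: its distance is the infimum of the lengths of paths, and every point `x` is the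
centre of a ball isometric to the ball of the same radius about a point in a closed convex subset
`K` with nonempty interior of `𝐇ⁿ`. Around points in the interior of `M` this is a ball of `𝐇ⁿ`
(take `K = 𝐇ⁿ`), around points of a totally geodesic boundary it is half of such a ball (take for
`K` a half-space). -/
structure IsHyperbolicManifold (n : ℕ) (M : Type*) [MetricSpace M] : Prop where
  length_metric : ∀ x y : M, ∀ ε : ℝ, 0 < ε →
    ∃ γ : Path x y, eVariationOn γ Set.univ ≤ ENNReal.ofReal (dist x y + ε)
  locally_hyperbolic : ∀ x : M, ∃ r : ℝ, 0 < r ∧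
    ∃ K : Set (HypSpace n), IsClosed K ∧ GeodesicallyConvex K ∧ (interior K).Nonempty ∧
    ∃ φ : M → HypSpace n,
      (∀ y ∈ Metric.ball x r, ∀ z ∈ Metric.ball x r, dist (φ y) (φ z) = dist y z) ∧
      φ '' Metric.ball x r = K ∩ Metric.ball (φ x) r

/-- A closed geodesic of length `L > 0`: an `L`-periodic curve `ℝ → M` parametrized by arc length
that is locally distance-realizing. (`L` need not be the least period.) -/
structure ClosedGeodesic (M : Type*) [MetricSpace M] where
  /-- the curve -/
  curve : ℝ → M
  /-- the length of the closed geodesic -/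
  length : ℝ
  length_pos : 0 < length
  periodic : Function.Periodic curve length
  locally_isometric : ∀ t : ℝ, ∃ ε > 0, ∀ s ∈ Metric.ball t ε, ∀ s' ∈ Metric.ball t ε,
    dist (curve s) (curve s') = dist s s'

namespace ClosedGeodesic

variable {M : Type*} [MetricSpace M]

theorem continuous_curve (c : ClosedGeodesic M) : Continuous c.curve := by
  rw [continuous_iff_continuousAt]
  intro t
  obtain ⟨ε, hε, h⟩ := c.locally_isometric t
  rw [Metric.continuousAt_iff]
  intro δ hδ
  refine ⟨min ε δ, lt_min hε hδ, fun {s} hs => ?_⟩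
  rw [h s (Metric.mem_ball.2 (hs.trans_le (min_le_left _ _))) t (Metric.mem_ball_self hε)]
  exact hs.trans_le (min_le_right _ _)

/-- The closed geodesic, run through once, as a loop on the unit interval. -/
def loop (c : ClosedGeodesic M) : Path (c.curve 0) (c.curve 0) where
  toFun t := c.curve (t * c.length)
  continuous_toFun := c.continuous_curve.comp (by fun_prop)
  source' := by simp
  target' := by simpa using c.periodic 0

/-- The closed geodesic lies in the free homotopy class of `α ∈ π₁(M, x₀)`: for some path `p` from
`x₀` to its starting point, `α` is the class of the loop `p · c · p⁻¹`. -/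
def Represents {x₀ : M} (c : ClosedGeodesic M) (α : FundamentalGroup M x₀) : Prop :=
  ∃ p : Path x₀ (c.curve 0),
    FundamentalGroup.toPath α = Path.Homotopic.Quotient.mk ((p.trans c.loop).trans p.symm)

end ClosedGeodesic

/-- `ℓ_ρ(α)`: the length of the geodesic representative of `α`, i.e. of the closed geodesic in the
free homotopy class of `α`. The value is `∞` if there is no such closed geodesic; in a compact
hyperbolic manifold all such closed geodesics have the same length, in general the infimum of their
lengths is taken. -/
def geodesicLength {M : Type*} [MetricSpace M] {x₀ : M} (α : FundamentalGroup M x₀) : ENNReal :=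
  ⨅ (c : ClosedGeodesic M) (_ : c.Represents α), ENNReal.ofReal c.length

/-! ### Residual finiteness growth -/

/-- The word length of `g` with respect to `S`: the least number of factors in an expression of `g`
as a product of elements of `S` and their inverses (`∞` if there is none). -/
def wordLength {G : Type*} [Group G] (S : Set G) (g : G) : ℕ∞ :=
  ⨅ (w : List G) (_ : (∀ s ∈ w, s ∈ S ∨ s⁻¹ ∈ S) ∧ w.prod = g), (w.length : ℕ∞)

/-- The divisibility function `D_G(g) = min {[G : H] : H ≤ G, g ∉ H} ∈ ℕ ∪ {∞}`. -/
def divisibility {G : Type*} [Group G] (g : G) : ℕ∞ :=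
  ⨅ (H : Subgroup G) (_ : g ∉ H), ENat.card (G ⧸ H)

/-- The residual finiteness function `DM_{G,S}(n) = max {D_G(g) : g ≠ 1, ‖g‖_S ≤ n}`
(`0` if there is no such `g`). -/
def residualGrowth {G : Type*} [Group G] (S : Set G) (n : ℕ) : ℕ∞ :=
  ⨆ (g : G) (_ : g ≠ 1 ∧ wordLength S g ≤ n), divisibility g

/-- The geodesic residual finiteness function
`DM_{M,ρ}(n) = max {D_{π₁(M)}(α) : α ≠ 1, ℓ_ρ(α) ≤ n}` (`0` if there is no such `α`). -/
def geodesicResidualGrowth (M : Type*) [MetricSpace M] (x₀ : M) (n : ℕ) : ℕ∞ :=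
  ⨆ (α : FundamentalGroup M x₀) (_ : α ≠ 1 ∧ geodesicLength α ≤ n), divisibility α

/-- `f ≼ g`: there is `C > 0` with `f(n) ≤ C g(Cn)` for all `n`. -/
def GrowthLE (f g : ℕ → ℕ∞) : Prop :=
  ∃ C : ℕ, 0 < C ∧ ∀ n : ℕ, f n ≤ C * g (C * n)

/-- `f ≃ g`: both `f ≼ g` and `g ≼ f`. -/
def GrowthEquiv (f g : ℕ → ℕ∞) : Prop := GrowthLE f g ∧ GrowthLE g f

end

noncomputable section
open Set Filter Topology NNReal

/-! ### Geodesic contraction of balls in convex subsets of hyperbolic space -/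

namespace HypSpace

variable {n : ℕ}

/-! Word length and geodesic length are both comparable with the number of short steps needed to go
from a point `a` of the universal cover to its translate by `α` (a `Chain`). Divisibility is
invariant under conjugation, so it does not matter which point `a` is used.

The local geometry enters only through two facts. Balls of a convex set in hyperbolic space are
contractible, so by compactness there is one radius `r` below which paths with the same endpoints
are homotopic (`SmallPathsHomotopic`). Since the metric is a length metric, nearby points are joined
by Lipschitz paths with nearly optimal constant (`LipschitzJoined`). The universal cover is then
handled without a topology: its points are homotopy classes of paths from `x₀`, and a curve in it is
continuous if it locally moves by short steps.

From words to geodesics: each generator is realized by a chain, and translated chains concatenate,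
so a word of length `n` gives a chain with `O(n)` steps. Such a chain closes up to a Lipschitz curve
in the free homotopy class of `α`. A curve of least Lipschitz constant in that class exists by
compactness. It is locally distance-realizing, since otherwise a shortcut would lower the constant;
this gives a closed geodesic no longer than the chain (`Chain.exists_closedGeodesic`).

From geodesics to words: a lift of a closed geodesic, cut into short pieces, is a chain. As in the
Švarc–Milnor lemma, pushing its vertices to a finite net turns each step into multiplication by one
of finitely many group elements, so some conjugate of `α` has word length linear in the number of
steps (`exists_conj_wordLength_le`). -/

theorem cosh_dist (x y : HypSpace n) : Real.cosh (dist x y) = coshDist x y :=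
  Real.cosh_arcosh (one_le_coshDist x y)

theorem continuous_coshDist_right (p : HypSpace n) : Continuous (coshDist p) := by
  have : coshDist p = fun y => Real.cosh (dist p y) := funext fun y => (cosh_dist p y).symm
  rw [this]
  fun_prop

/-- The point of `𝐇ⁿ` with given space-like coordinates. -/
def ofSpace (v : EuclideanSpace ℝ (Fin n)) : HypSpace n where
  time := √(1 + ‖v‖ ^ 2)
  space := v
  time_pos := by positivity
  time_sq := Real.sq_sqrt (by positivity)

theorem continuous_time : Continuous (time : HypSpace n → ℝ) := by
  have : (time : HypSpace n → ℝ) = coshDist (ofSpace 0) := by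
    funext y
    simp [coshDist, ofSpace]
  rw [this]
  exact continuous_coshDist_right _

theorem continuous_space : Continuous (space : HypSpace n → EuclideanSpace ℝ (Fin n)) := by
  refine (PiLp.continuous_toLp 2 _).comp (continuous_pi fun i => ?_)
  have h : (fun y : HypSpace n => y.space i) = fun y =>
      (ofSpace (EuclideanSpace.single i (1 : ℝ))).time * y.time
        - coshDist (ofSpace (EuclideanSpace.single i (1 : ℝ))) y := by
    funext y
    simp [coshDist, ofSpace, EuclideanSpace.inner_single_left]
  change Continuous fun y : HypSpace n => y.space i
  rw [h]
  exact (continuous_const.mul continuous_time).sub (continuous_coshDist_right _)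

/-- The metric topology is that of the coordinates: the distance is `arcosh`, continuous on `[1,
∞)`, of a polynomial in them. -/
theorem continuous_of_coordinates {X : Type*} [TopologicalSpace X] {f : X → HypSpace n}
    (ht : Continuous fun a => (f a).time) (hs : Continuous fun a => (f a).space) :
    Continuous f := by
  rw [continuous_iff_continuousAt]
  intro a
  rw [ContinuousAt, tendsto_iff_dist_tendsto_zero]
  have h1 : Continuous fun b => coshDist (f b) (f a) := by
    unfold coshDist
    fun_prop
  have h2 : Continuous fun b => Real.arcosh (coshDist (f b) (f a)) :=
    Real.continuousOn_arcosh.comp_continuous h1 fun b => one_le_coshDist _ _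
  have h3 := h2.tendsto a
  rwa [coshDist_self, Real.arcosh_zero] at h3

/-- The squared Minkowski norm of `(1 - t) y + t x`. -/
theorem combo_norm_sq (x y : HypSpace n) (t : ℝ) :
    ((1 - t) * y.time + t * x.time) ^ 2 - ‖(1 - t) • y.space + t • x.space‖ ^ 2
      = 1 + 2 * t * (1 - t) * (coshDist x y - 1) := by
  rw [norm_add_sq_real, norm_smul, norm_smul, mul_pow, mul_pow, Real.norm_eq_abs,
    Real.norm_eq_abs, sq_abs, sq_abs, real_inner_smul_left, real_inner_smul_right,
    real_inner_comm]
  unfold coshDist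
  linear_combination (1 - t) ^ 2 * y.time_sq + t ^ 2 * x.time_sq

theorem one_le_combo (x y : HypSpace n) (t : unitInterval) :
    1 ≤ 1 + 2 * (t : ℝ) * (1 - t) * (coshDist x y - 1) := by
  have h1 := one_le_coshDist x y
  have h2 := t.2.1
  have h3 := t.2.2
  have : 0 ≤ 2 * (t : ℝ) * (1 - t) * (coshDist x y - 1) :=
    mul_nonneg (mul_nonneg (by linarith) (by linarith)) (by linarith)
  linarith

/-- The point dividing the geodesic segment from `y` to `x` that lies on the ray through
`(1 - t) y + t x`. -/
def combo (x y : HypSpace n) (t : unitInterval) : HypSpace n where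
  time := ((1 - t) * y.time + t * x.time) / √(1 + 2 * (t : ℝ) * (1 - t) * (coshDist x y - 1))
  space := (√(1 + 2 * (t : ℝ) * (1 - t) * (coshDist x y - 1)))⁻¹ •
    ((1 - (t : ℝ)) • y.space + (t : ℝ) • x.space)
  time_pos := by
    have h := one_le_combo x y t
    refine div_pos ?_ (Real.sqrt_pos.2 (by linarith))
    have hx := x.time_pos
    have hy := y.time_pos
    rcases t.2.1.eq_or_lt with h0 | h0
    · rw [← h0]; simpa using hy
    · have := mul_pos h0 hx
      have := mul_nonneg (sub_nonneg.2 t.2.2) hy.le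
      linarith
  time_sq := by
    have h := one_le_combo x y t
    have hq := combo_norm_sq x y t
    have hN := Real.sq_sqrt (show 0 ≤ 1 + 2 * (t : ℝ) * (1 - t) * (coshDist x y - 1) by linarith)
    have hN0 : 0 < √(1 + 2 * (t : ℝ) * (1 - t) * (coshDist x y - 1)) :=
      Real.sqrt_pos.2 (by linarith)
    rw [norm_smul, mul_pow, norm_inv, Real.norm_eq_abs, inv_pow, sq_abs, div_pow]
    set N := √(1 + 2 * (t : ℝ) * (1 - t) * (coshDist x y - 1))
    field_simp
    linarith

theorem coshDist_combo_left (x y : HypSpace n) (t : unitInterval) :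
    coshDist x (combo x y t) = ((1 - t) * coshDist x y + t) /
      √(1 + 2 * (t : ℝ) * (1 - t) * (coshDist x y - 1)) := by
  have hx := x.time_sq
  simp only [coshDist, combo, real_inner_smul_right, inner_add_right, real_inner_self_eq_norm_sq]
  rw [div_eq_inv_mul, div_eq_inv_mul]
  generalize (√(1 + 2 * (t : ℝ) * (1 - t) * (x.time * y.time - inner ℝ x.space y.space - 1)))⁻¹ = N
  linear_combination N * t * hx

theorem coshDist_combo_right (x y : HypSpace n) (t : unitInterval) :
    coshDist (combo x y t) y = ((1 - t) + t * coshDist x y) /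
      √(1 + 2 * (t : ℝ) * (1 - t) * (coshDist x y - 1)) := by
  have hy := y.time_sq
  simp only [coshDist, combo, real_inner_smul_left, inner_add_left, real_inner_self_eq_norm_sq]
  rw [div_eq_inv_mul, div_eq_inv_mul]
  generalize (√(1 + 2 * (t : ℝ) * (1 - t) * (x.time * y.time - inner ℝ x.space y.space - 1)))⁻¹ = N
  linear_combination N * (1 - t) * hy

/-- The two pieces have hyperbolic sines `(1 - t) sinh d / N` and `t sinh d / N`, where `d` is the
distance and `N` the normalizing root; the addition formula for `cosh` then returns `cosh d`. Being
metrically between, the point is caught by `GeodesicallyConvex`. -/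
theorem dist_combo_add (x y : HypSpace n) (t : unitInterval) :
    dist x (combo x y t) + dist (combo x y t) y = dist x y := by
  have h := one_le_combo x y t
  have hl := coshDist_combo_left x y t
  have hr := coshDist_combo_right x y t
  have hN := Real.sq_sqrt (show 0 ≤ 1 + 2 * (t : ℝ) * (1 - t) * (coshDist x y - 1) by linarith)
  have hN0 : 0 < √(1 + 2 * (t : ℝ) * (1 - t) * (coshDist x y - 1)) :=
    Real.sqrt_pos.2 (by linarith)
  set N := √(1 + 2 * (t : ℝ) * (1 - t) * (coshDist x y - 1))
  have hc := one_le_coshDist x y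
  have hs : 0 ≤ Real.sinh (dist x y) := Real.sinh_nonneg_iff.2 dist_nonneg
  have hs2 : Real.sinh (dist x y) ^ 2 = coshDist x y ^ 2 - 1 := by
    rw [Real.sinh_sq, cosh_dist]
  have e1 : Real.sinh (dist x (combo x y t)) = (1 - t) * Real.sinh (dist x y) / N := by
    refine (sq_eq_sq₀ (Real.sinh_nonneg_iff.2 dist_nonneg) (div_nonneg (mul_nonneg
      (sub_nonneg.2 t.2.2) hs) hN0.le)).1 ?_
    rw [Real.sinh_sq, cosh_dist, hl, div_pow, div_pow, mul_pow, hs2]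
    field_simp
    rw [hN]
    ring
  have e2 : Real.sinh (dist (combo x y t) y) = t * Real.sinh (dist x y) / N := by
    refine (sq_eq_sq₀ (Real.sinh_nonneg_iff.2 dist_nonneg) (div_nonneg (mul_nonneg
      t.2.1 hs) hN0.le)).1 ?_
    rw [Real.sinh_sq, cosh_dist, hr, div_pow, div_pow, mul_pow, hs2]
    field_simp
    rw [hN]
    ring
  rw [← Real.arcosh_cosh (add_nonneg (dist_nonneg (x := x) (y := combo x y t))
    (dist_nonneg (x := combo x y t) (y := y))), Real.cosh_add, cosh_dist, cosh_dist, e1, e2, hl, hr]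
  change _ = Real.arcosh (coshDist x y)
  congr 1
  field_simp
  rw [hN, hs2]
  ring

theorem continuous_combo (x : HypSpace n) :
    Continuous fun p : unitInterval × HypSpace n => combo x p.2 p.1 := by
  have h1 : Continuous fun p : unitInterval × HypSpace n => p.2.time :=
    continuous_time.comp continuous_snd
  have h2 : Continuous fun p : unitInterval × HypSpace n => p.2.space :=
    continuous_space.comp continuous_snd
  have h3 : Continuous fun p : unitInterval × HypSpace n =>
      √(1 + 2 * (p.1 : ℝ) * (1 - p.1) * (coshDist x p.2 - 1)) := by
    have := (continuous_coshDist_right x).comp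
      (continuous_snd : Continuous fun p : unitInterval × HypSpace n => p.2)
    simp only [Function.comp_def] at this
    fun_prop
  have h4 (p : unitInterval × HypSpace n) :
      √(1 + 2 * (p.1 : ℝ) * (1 - p.1) * (coshDist x p.2 - 1)) ≠ 0 :=
    (Real.sqrt_pos.2 (by linarith [one_le_combo x p.2 p.1])).ne'
  refine continuous_of_coordinates ?_ ?_
  · exact Continuous.div (by fun_prop) h3 h4
  · exact (h3.inv₀ h4).smul (by fun_prop)

theorem combo_zero (x y : HypSpace n) : combo x y 0 = y := by
  ext <;> simp [combo]

theorem combo_one (x y : HypSpace n) : combo x y 1 = x := by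
  ext <;> simp [combo]

/-- A ball of a convex set is contractible. -/
theorem contractibleSpace_inter_ball {K : Set (HypSpace n)} (hK : GeodesicallyConvex K)
    {x : HypSpace n} {r : ℝ} (hx : x ∈ K) (hr : 0 < r) :
    ContractibleSpace ↥(K ∩ Metric.ball x r) := by
  rw [contractible_iff_id_nullhomotopic]
  refine ⟨⟨x, hx, Metric.mem_ball_self hr⟩, ⟨⟨⟨fun p => ⟨combo x p.2 p.1, ?_, ?_⟩, ?_⟩, ?_, ?_⟩⟩⟩
  · exact hK x hx p.2 p.2.2.1 _ (dist_combo_add x p.2 p.1)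
  · have h1 := dist_combo_add x (p.2 : HypSpace n) p.1
    have h2 := p.2.2.2
    rw [Metric.mem_ball, dist_comm] at h2 ⊢
    linarith [dist_nonneg (x := combo x (p.2 : HypSpace n) p.1) (y := p.2)]
  · exact Continuous.subtype_mk ((continuous_combo x).comp
      (continuous_fst.prodMk (continuous_subtype_val.comp continuous_snd))) _
  · intro y
    exact Subtype.ext (combo_zero x y)
  · intro y
    exact Subtype.ext (combo_one x y)

end HypSpace

/-- Any two paths with the same endpoints in a common ball of radius `r` are homotopic in `M`. -/
def SmallPathsHomotopic (M : Type*) [MetricSpace M] (r : ℝ) : Prop :=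
  ∀ (z y y' : M) (p q : Path y y'), (∀ t, p t ∈ Metric.ball z r) → (∀ t, q t ∈ Metric.ball z r) →
    p.Homotopic q

/-! ### A uniform scale of simple connectivity -/

theorem Path.homotopic_of_simplyConnected_subset {X : Type*} [TopologicalSpace X] {s : Set X}
    [SimplyConnectedSpace s] {y y' : X} (p q : Path y y') (hp : ∀ t, p t ∈ s)
    (hq : ∀ t, q t ∈ s) : p.Homotopic q := by
  have hy : y ∈ s := by simpa using hp 0
  have hy' : y' ∈ s := by simpa using hp 1
  let p' : Path (⟨y, hy⟩ : s) ⟨y', hy'⟩ :=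
    ⟨⟨fun t => ⟨p t, hp t⟩, by fun_prop⟩, by simp, by simp⟩
  let q' : Path (⟨y, hy⟩ : s) ⟨y', hy'⟩ :=
    ⟨⟨fun t => ⟨q t, hq t⟩, by fun_prop⟩, by simp, by simp⟩
  exact (SimplyConnectedSpace.paths_homotopic p' q').map ⟨_, continuous_subtype_val⟩

theorem IsHyperbolicManifold.exists_simplyConnected_ball {n : ℕ} {M : Type*} [MetricSpace M]
    (hM : IsHyperbolicManifold n M) (x : M) :
    ∃ r : ℝ, 0 < r ∧ SimplyConnectedSpace (Metric.ball x r) := by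
  obtain ⟨r, hr, K, -, hK, -, φ, hφ, him⟩ := hM.locally_hyperbolic x
  refine ⟨r, hr, ?_⟩
  have hiso : Isometry fun y : Metric.ball x r => φ y :=
    Isometry.of_dist_eq fun y z => hφ y y.2 z z.2
  have hrange : range (fun y : Metric.ball x r => φ y) = K ∩ Metric.ball (φ x) r := by
    rw [← him, image_eq_range]
  have hx : φ x ∈ K := by
    have : φ x ∈ φ '' Metric.ball x r := ⟨x, Metric.mem_ball_self hr, rfl⟩
    rw [him] at this
    exact this.1
  have := HypSpace.contractibleSpace_inter_ball hK hx hr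
  rw [← hrange] at this
  have : ContractibleSpace (Metric.ball x r) :=
    hiso.isometryEquivOnRange.toHomeomorph.contractibleSpace
  infer_instance

theorem IsHyperbolicManifold.exists_smallPathsHomotopic {n : ℕ} {M : Type*} [MetricSpace M]
    [CompactSpace M] (hM : IsHyperbolicManifold n M) :
    ∃ r : ℝ, 0 < r ∧ SmallPathsHomotopic M r := by
  choose r hr hsc using hM.exists_simplyConnected_ball
  -- A Lebesgue number of the cover by simply connected balls: the balls of radius `δ` need not be
  -- simply connected themselves, but each lies in one that is.
  obtain ⟨δ, hδ, h⟩ := lebesgue_number_lemma_of_metric (s := univ) (c := fun x => Metric.ball x (r x))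
    isCompact_univ (fun x => Metric.isOpen_ball)
    (fun x _ => mem_iUnion.2 ⟨x, Metric.mem_ball_self (hr x)⟩)
  refine ⟨δ, hδ, fun z y y' p q hp hq => ?_⟩
  obtain ⟨x, hx⟩ := h z (mem_univ z)
  have := hsc x
  exact Path.homotopic_of_simplyConnected_subset p q (fun t => hx (hp t)) fun t => hx (hq t)

/-- Points at distance less than `K` are joined by a `K`-Lipschitz path. -/
def LipschitzJoined (M : Type*) [MetricSpace M] : Prop :=
  ∀ (x y : M) (K : ℝ≥0), dist x y < K → ∃ e : ℝ → M, LipschitzWith K e ∧ e 0 = x ∧ e 1 = y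

/-! ### Lipschitz reparametrization of paths of finite length -/

section Variation

variable {α E : Type*} [LinearOrder α] [PseudoMetricSpace E]

theorem dist_le_abs_variationOnFromTo_sub {f : α → E} (hf : BoundedVariationOn f univ) (a b c : α) :
    dist (f b) (f c) ≤ |variationOnFromTo f univ a b - variationOnFromTo f univ a c| := by
  wlog hbc : b ≤ c generalizing b c
  · rw [dist_comm, abs_sub_comm]
    exact this c b (le_of_not_ge hbc)
  rw [variationOnFromTo.sub_right hf.locallyBoundedVariationOn (mem_univ a) (mem_univ b)
    (mem_univ c), variationOnFromTo.eq_of_ge _ _ hbc, abs_neg, ENNReal.abs_toReal]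
  have hb : BoundedVariationOn f (univ ∩ Icc b c) := hf.mono inter_subset_left
  exact hb.dist_le ⟨mem_univ _, left_mem_Icc.2 hbc⟩ ⟨mem_univ _, right_mem_Icc.2 hbc⟩

theorem Continuous.continuous_variationOnFromTo [TopologicalSpace α] [OrderTopology α]
    {f : α → E} (hc : Continuous f)
    (hf : LocallyBoundedVariationOn f univ) (a : α) :
    Continuous (variationOnFromTo f univ a) := by
  refine continuous_iff_continuousAt.2 fun b => continuousAt_iff_continuous_left'_right'.2 ⟨?_, ?_⟩
  · have h := variationOnFromTo.tendsto_left (mem_univ a) (mem_univ b) hf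
      ((hc.tendsto b).mono_left nhdsWithin_le_nhds)
    simpa [ContinuousWithinAt] using h
  · have h := variationOnFromTo.tendsto_right (mem_univ a) (mem_univ b) hf
      ((hc.tendsto b).mono_left nhdsWithin_le_nhds)
    simpa [ContinuousWithinAt] using h

end Variation

/-- Reparametrization proportional to arc length. The curve is extended to be constant on each side
of `[0, 1]`. -/
theorem Path.exists_lipschitz {M : Type*} [MetricSpace M] {x y : M} (γ : Path x y) {V : ℝ≥0}
    (hV : eVariationOn γ univ ≤ V) : ∃ e : ℝ → M, LipschitzWith V e ∧ e 0 = x ∧ e 1 = y := by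
  have hb : BoundedVariationOn γ univ := (hV.trans_lt ENNReal.coe_lt_top).ne
  set v := variationOnFromTo γ univ 0 with hv
  have hvc : Continuous v := γ.continuous.continuous_variationOnFromTo
    hb.locallyBoundedVariationOn 0
  have hv0 : v 0 = 0 := variationOnFromTo.self _ _ _
  have hv1 : v 1 ≤ V := by
    rw [hv, variationOnFromTo.eq_of_le _ _ zero_le_one]
    refine ENNReal.toReal_le_coe_of_le_coe (le_trans (eVariationOn.mono _ (subset_univ _)) hV)
  have hv1' : 0 ≤ v 1 := variationOnFromTo.nonneg_of_le _ _ zero_le_one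
  have hsurj : ∀ s : ℝ, ∃ t, v t = v 1 * projIcc (0 : ℝ) 1 zero_le_one s := by
    intro s
    set p := projIcc (0 : ℝ) 1 zero_le_one s
    have : v 1 * p ∈ Icc (v 0) (v 1) := by
      rw [hv0]
      exact ⟨mul_nonneg hv1' p.2.1, mul_le_of_le_one_right hv1' p.2.2⟩
    obtain ⟨t, -, ht⟩ := intermediate_value_Icc zero_le_one hvc.continuousOn this
    exact ⟨t, ht⟩
  -- An arbitrary right inverse, possibly discontinuous where `γ` rests. This is harmless: distances
  -- along `γ` are bounded by differences of `v`, so `γ (b s)` depends only on `v (b s)`; likewise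
  -- for the endpoints, where `b 0` need not be `0`.
  choose b hbv using hsurj
  refine ⟨fun s => γ (b s), LipschitzWith.of_dist_le_mul fun s s' => ?_, ?_, ?_⟩
  · refine (dist_le_abs_variationOnFromTo_sub hb 0 _ _).trans ?_
    rw [← hv, hbv, hbv, ← mul_sub, abs_mul, abs_of_nonneg hv1']
    have := abs_projIcc_sub_projIcc zero_le_one (c := s) (d := s')
    rw [Real.dist_eq]
    exact mul_le_mul hv1 this (abs_nonneg _) V.2
  · have h := dist_le_abs_variationOnFromTo_sub hb 0 (b 0) 0
    rw [← hv, hbv, hv0] at h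
    simpa using h
  · have h := dist_le_abs_variationOnFromTo_sub hb 0 (b 1) 1
    rw [← hv, hbv] at h
    simpa using h

theorem IsHyperbolicManifold.lipschitzJoined {n : ℕ} {M : Type*} [MetricSpace M]
    (hM : IsHyperbolicManifold n M) : LipschitzJoined M := by
  intro x y K hK
  obtain ⟨γ, hγ⟩ := hM.length_metric x y (K - dist x y) (sub_pos.2 hK)
  rw [add_sub_cancel, ENNReal.ofReal_coe_nnreal] at hγ
  exact γ.exists_lipschitz hγ

/-! ### Homotopy classes of short paths -/

section ShortClass

variable {M : Type*} [MetricSpace M] {r : ℝ}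

theorem LipschitzJoined.exists_path (hL : LipschitzJoined M) {x y : M} {ρ : ℝ} (h : dist x y < ρ) :
    ∃ p : Path x y, ∀ t, p t ∈ Metric.ball x ρ := by
  obtain ⟨K, hK1, hK2⟩ := exists_between h
  lift K to ℝ≥0 using dist_nonneg.trans hK1.le
  obtain ⟨e, he, h0, h1⟩ := hL x y K hK1
  refine ⟨⟨⟨fun t => e t, he.continuous.comp continuous_subtype_val⟩, by simpa, by simpa⟩,
    fun t => ?_⟩
  have h2 := he.dist_le_mul t 0
  rw [h0, Real.dist_eq, sub_zero, abs_of_nonneg t.2.1] at h2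
  exact h2.trans_lt ((mul_le_of_le_one_right K.2 t.2.2).trans_lt hK2)

theorem LipschitzJoined.exists_shortPath (hL : LipschitzJoined M) (r : ℝ) (x y : M) :
    ∃ p : Path x y, dist x y < r → ∀ t, p t ∈ Metric.ball x r := by
  by_cases h : dist x y < r
  · obtain ⟨p, hp⟩ := hL.exists_path h
    exact ⟨p, fun _ => hp⟩
  · obtain ⟨p, -⟩ := hL.exists_path (lt_add_one (dist x y))
    exact ⟨p, fun h' => absurd h' h⟩

/-- The homotopy class of the paths from `x` to `y` in the ball of radius `r` about `x`. -/
def shortClass (hL : LipschitzJoined M) (r : ℝ) (x y : M) : Path.Homotopic.Quotient x y :=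
  Path.Homotopic.Quotient.mk (hL.exists_shortPath r x y).choose

variable (hL : LipschitzJoined M) (hr : SmallPathsHomotopic M r)
include hr

theorem mk_eq_shortClass {x y : M} (p : Path x y) (hp : ∀ t, p t ∈ Metric.ball x r) :
    Path.Homotopic.Quotient.mk p = shortClass hL r x y := by
  refine Path.Homotopic.Quotient.eq.2 (hr x x y _ _ hp ((hL.exists_shortPath r x y).choose_spec ?_))
  have := hp 1
  rwa [p.target, Metric.mem_ball'] at this

theorem shortClass_trans {x y z : M} (h : dist x y + dist y z < r) :
    (shortClass hL r x y).trans (shortClass hL r y z) = shortClass hL r x z := by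
  -- The radii leave room for the other leg, so that the concatenation stays in the ball of radius
  -- `r` about `x`.
  obtain ⟨p, hp⟩ := hL.exists_path (x := x) (y := y) (ρ := r - dist y z) (by linarith)
  obtain ⟨q, hq⟩ := hL.exists_path (x := y) (y := z) (ρ := r - dist x y) (by linarith)
  have hxy := dist_nonneg (x := x) (y := y)
  have hyz := dist_nonneg (x := y) (y := z)
  rw [← mk_eq_shortClass hL hr p fun t => Metric.ball_subset_ball (by linarith) (hp t),
    ← mk_eq_shortClass hL hr q fun t => Metric.ball_subset_ball (by linarith) (hq t),
    ← Path.Homotopic.Quotient.mk_trans, mk_eq_shortClass hL hr]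
  intro t
  have ht : (p.trans q) t ∈ range p ∪ range q := by
    rw [← Path.trans_range]
    exact mem_range_self t
  rcases ht with ⟨s, hs⟩ | ⟨s, hs⟩
  · rw [← hs]
    exact Metric.ball_subset_ball (by linarith) (hp s)
  · rw [← hs]
    have h1 := Metric.mem_ball.1 (hq s)
    have h2 := dist_triangle_right (q s) x y
    rw [Metric.mem_ball]
    linarith

theorem shortClass_self (h : 0 < r) (x : M) : shortClass hL r x x = Path.Homotopic.Quotient.refl x :=
  (mk_eq_shortClass hL hr (Path.refl x) fun _ => Metric.mem_ball_self h).symm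

end ShortClass

/-! ### The path model of the universal cover -/

/-- The points of the universal cover of `M`: homotopy classes of paths starting at `x₀`. -/
abbrev PathCover {M : Type*} [MetricSpace M] (x₀ : M) := Σ y : M, Path.Homotopic.Quotient x₀ y

namespace PathCover

variable {M : Type*} [MetricSpace M] {x₀ : M} {r : ℝ}

/-- The base point of the universal cover. -/
def base (x₀ : M) : PathCover x₀ := ⟨x₀, Path.Homotopic.Quotient.refl x₀⟩

/-- The deck transformation given by a loop class. -/
def deck (α : Path.Homotopic.Quotient x₀ x₀) (a : PathCover x₀) : PathCover x₀ :=
  ⟨a.1, α.trans a.2⟩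

/-- The point over `y` reached from `a` along a short path. -/
def step (hL : LipschitzJoined M) (r : ℝ) (a : PathCover x₀) (y : M) : PathCover x₀ :=
  ⟨y, a.2.trans (shortClass hL r a.1 y)⟩

@[simp] theorem deck_fst (α : Path.Homotopic.Quotient x₀ x₀) (a : PathCover x₀) :
    (deck α a).1 = a.1 := rfl

@[simp] theorem step_fst (hL : LipschitzJoined M) (a : PathCover x₀) (y : M) :
    (step hL r a y).1 = y := rfl

theorem deck_refl (a : PathCover x₀) : deck (Path.Homotopic.Quotient.refl x₀) a = a := by
  simp [deck]

theorem deck_trans (α β : Path.Homotopic.Quotient x₀ x₀) (a : PathCover x₀) :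
    deck (α.trans β) a = deck α (deck β a) := by
  simp [deck, Path.Homotopic.Quotient.trans_assoc]

/-- The action of loop classes is free: the path class of `a` cancels on the right. -/
theorem eq_of_deck_eq {α β : Path.Homotopic.Quotient x₀ x₀} {a : PathCover x₀}
    (h : deck α a = deck β a) :
    α = β := by
  have h1 : α.trans a.2 = β.trans a.2 := eq_of_heq (Sigma.mk.inj h).2
  rw [← Path.Homotopic.Quotient.trans_refl α, ← Path.Homotopic.Quotient.trans_refl β,
    ← Path.Homotopic.Quotient.trans_symm a.2,
    ← Path.Homotopic.Quotient.trans_assoc, ← Path.Homotopic.Quotient.trans_assoc, h1]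

/-- Deck transformations prepend a loop and steps append a path, so they commute by associativity.
-/
theorem step_deck (hL : LipschitzJoined M) (α : Path.Homotopic.Quotient x₀ x₀) (a : PathCover x₀)
    (y : M) : step hL r (deck α a) y = deck α (step hL r a y) := by
  simp [deck, step, Path.Homotopic.Quotient.trans_assoc]

variable (hL : LipschitzJoined M) (hr : SmallPathsHomotopic M r)
include hr

theorem step_step {a : PathCover x₀} {y z : M} (h : dist a.1 y + dist y z < r) :
    step hL r (step hL r a y) z = step hL r a z := by
  simp only [step]
  rw [Path.Homotopic.Quotient.trans_assoc, shortClass_trans hL hr h]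

theorem step_self (h : 0 < r) (a : PathCover x₀) : step hL r a a.1 = a := by
  simp only [step]
  rw [shortClass_self hL hr h, Path.Homotopic.Quotient.trans_refl]

end PathCover

open PathCover

/-! ### Lifts of curves -/

section Lifts

variable {M : Type*} [MetricSpace M] {x₀ : M} {r : ℝ}

/-- The path `f` runs through from time `a` to time `b`. -/
def pathOn (f : ℝ → M) (hf : Continuous f) (a b : ℝ) : Path (f a) (f b) where
  toFun t := f (AffineMap.lineMap a b (t : ℝ))
  continuous_toFun := by
    have : Continuous fun t : unitInterval => AffineMap.lineMap a b (t : ℝ) := by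
      simp only [AffineMap.lineMap_apply]
      fun_prop
    exact hf.comp this
  source' := by simp
  target' := by simp

theorem pathOn_apply_mem (f : ℝ → M) (hf : Continuous f) (a b : ℝ) {s : Set M}
    (h : ∀ t ∈ uIcc a b, f t ∈ s) (t : unitInterval) : pathOn f hf a b t ∈ s := by
  refine h _ ?_
  rw [← segment_eq_uIcc, segment_eq_image_lineMap]
  exact ⟨t, t.2, rfl⟩

/-- The homotopy is the image under `f` of one in the simply connected line. -/
theorem mk_pathOn_trans (f : ℝ → M) (hf : Continuous f) (a b c : ℝ) :
    (Path.Homotopic.Quotient.mk (pathOn f hf a b)).trans (Path.Homotopic.Quotient.mk (pathOn f hf b c))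
      = Path.Homotopic.Quotient.mk (pathOn f hf a c) := by
  have h := SimplyConnectedSpace.paths_homotopic
    ((pathOn id continuous_id a b).trans (pathOn id continuous_id b c))
    (pathOn id continuous_id a c)
  have h2 := h.map (⟨f, hf⟩ : C(ℝ, M))
  rw [Path.map_trans] at h2
  rw [← Path.Homotopic.Quotient.mk_trans]
  exact Path.Homotopic.Quotient.eq.2 h2

theorem mk_pathOn_self (f : ℝ → M) (hf : Continuous f) (a : ℝ) :
    Path.Homotopic.Quotient.mk (pathOn f hf a a) = Path.Homotopic.Quotient.refl (f a) := by
  rw [← Path.Homotopic.Quotient.mk_refl]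
  congr 1
  ext t
  simp [pathOn]

/-- The endpoints of `p` equal `f 0` and `f 1` only propositionally; equalities in the sigma type
carry the path classes across without casts. -/
theorem exists_mk_pathOn_eq (f : ℝ → M) (hf : Continuous f) {y z : M} (p : Path y z)
    (hp : ∀ t : unitInterval, p t = f t) (q : Path.Homotopic.Quotient x₀ y) :
    ∃ u : Path.Homotopic.Quotient x₀ (f 0), (⟨f 0, u⟩ : PathCover x₀) = ⟨y, q⟩ ∧
      (⟨f 1, u.trans (Path.Homotopic.Quotient.mk (pathOn f hf 0 1))⟩ : PathCover x₀)
        = ⟨z, q.trans (Path.Homotopic.Quotient.mk p)⟩ := by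
  have hy : y = f 0 := by simpa using hp 0
  have hz : z = f 1 := by simpa using hp 1
  subst hy hz
  refine ⟨q, rfl, ?_⟩
  have : p = pathOn f hf 0 1 := by
    ext t
    simp [pathOn, hp, AffineMap.lineMap_apply]
  rw [this]

/-- `F` is a continuous curve in the universal cover. -/
structure IsLift (hL : LipschitzJoined M) (r : ℝ) (F : ℝ → PathCover x₀) : Prop where
  continuous_fst : Continuous fun t => (F t).1
  eventually_eq : ∀ t₀, ∀ᶠ t in 𝓝 t₀, F t = step hL r (F t₀) (F t).1

/-- The `1`-periodic curve `f` lies in the free homotopy class given by the loop class `α`. -/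
def FreeClass (hL : LipschitzJoined M) (r : ℝ)
    (α : Path.Homotopic.Quotient x₀ x₀) (f : ℝ → M) : Prop :=
  ∃ F : ℝ → PathCover x₀, IsLift hL r F ∧ (∀ t, (F t).1 = f t) ∧ ∀ t, F (t + 1) = deck α (F t)

variable {hL : LipschitzJoined M} (hr : SmallPathsHomotopic M r)
include hr

theorem isLift_pathOn (h : 0 < r) (f : ℝ → M) (hf : Continuous f) (a : ℝ)
    (u : Path.Homotopic.Quotient x₀ (f a)) :
    IsLift hL r fun t =>
      (⟨f t, u.trans (Path.Homotopic.Quotient.mk (pathOn f hf a t))⟩ : PathCover x₀) := by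
  refine ⟨hf, fun t₀ => ?_⟩
  obtain ⟨ε, hε, hb⟩ := Metric.continuousAt_iff.1 (hf.continuousAt (x := t₀)) r h
  filter_upwards [Metric.ball_mem_nhds t₀ hε] with t ht
  simp only [step]
  rw [Path.Homotopic.Quotient.trans_assoc, ← mk_eq_shortClass hL hr (pathOn f hf t₀ t),
    mk_pathOn_trans]
  refine pathOn_apply_mem f hf _ _ fun s hs => hb ?_
  have := abs_sub_left_of_mem_uIcc hs
  rw [Metric.mem_ball, Real.dist_eq] at ht
  rw [Real.dist_eq]
  exact this.trans_lt ht

/-- Uniqueness of lifts: the set of times where the lifts agree is open and closed in the line. -/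
theorem IsLift.eq_of_eq (h : 0 < r) {F G : ℝ → PathCover x₀} (hF : IsLift hL r F)
    (hG : IsLift hL r G) (hFG : ∀ t, (F t).1 = (G t).1) {a : ℝ} (ha : F a = G a) : F = G := by
  have key : ∀ t₀, ∀ᶠ t in 𝓝 t₀, (F t = G t ↔ F t₀ = G t₀) := by
    intro t₀
    -- The sum is that of a step there and back. When it is less than `r` the step can be undone, so
    -- agreement at `t` passes back to `t₀`, giving closedness.
    have hd : ∀ᶠ t in 𝓝 t₀, dist (F t₀).1 (F t).1 + dist (F t).1 (F t₀).1 < r := by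
      have hc : Continuous fun t => dist (F t₀).1 (F t).1 + dist (F t).1 (F t₀).1 :=
        (continuous_const.dist hF.continuous_fst).add (hF.continuous_fst.dist continuous_const)
      exact hc.continuousAt.eventually_lt continuousAt_const (by simpa using h)
    filter_upwards [hF.eventually_eq t₀, hG.eventually_eq t₀, hd] with t h1 h2 h3
    constructor
    · intro he
      have e1 := step_step hL hr h3
      have e2 := step_step hL hr (a := G t₀) (by rwa [← hFG])
      rw [← hFG t, ← he] at h2
      rw [step_self hL hr h, ← h1] at e1
      rw [← h2, hFG t₀, step_self hL hr h] at e2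
      rw [← e1, ← e2, hFG t₀]
    · intro he
      rw [h1, h2, he, hFG]
  have hcl : IsClopen {t | F t = G t} := by
    constructor
    · rw [← isOpen_compl_iff, isOpen_iff_mem_nhds]
      intro t ht
      filter_upwards [key t] with s hs
      exact fun hs' => ht (hs.1 hs')
    · rw [isOpen_iff_mem_nhds]
      intro t ht
      filter_upwards [key t] with s hs
      exact hs.2 ht
  have := hcl.eq_univ ⟨a, ha⟩
  funext t
  exact this.ge (mem_univ t)

theorem IsLift.eq_pathOn (h : 0 < r) {F : ℝ → PathCover x₀} (hF : IsLift hL r F) (a b : ℝ) :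
    F b = ⟨(F b).1, (F a).2.trans (Path.Homotopic.Quotient.mk (pathOn _ hF.continuous_fst a b))⟩ := by
  have := hF.eq_of_eq hr h (isLift_pathOn hr h _ hF.continuous_fst a (F a).2) (fun t => rfl)
    (a := a) (by rw [mk_pathOn_self, Path.Homotopic.Quotient.trans_refl])
  exact congrFun this b

/-- As long as the projected curve stays in the ball of radius `r` about its start, the lift is
determined by a single short step. -/
theorem IsLift.eq_step (h : 0 < r) {F : ℝ → PathCover x₀} (hF : IsLift hL r F) {a b : ℝ}
    (hab : ∀ t ∈ uIcc a b, dist (F t).1 (F a).1 < r) : F b = step hL r (F a) (F b).1 := by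
  refine (hF.eq_pathOn hr h a b).trans ?_
  simp only [step]
  rw [mk_eq_shortClass hL hr]
  exact pathOn_apply_mem _ _ _ _ hab

omit hr in
theorem FreeClass.continuous {α : Path.Homotopic.Quotient x₀ x₀} {f : ℝ → M}
    (hf : FreeClass hL r α f) :
    Continuous f := by
  obtain ⟨F, hF, h, -⟩ := hf
  exact hF.continuous_fst.congr h

omit hr in
theorem FreeClass.periodic {α : Path.Homotopic.Quotient x₀ x₀} {f : ℝ → M}
    (hf : FreeClass hL r α f) : Function.Periodic f 1 := by
  obtain ⟨F, -, h, hp⟩ := hf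
  intro t
  rw [← h, ← h, hp, deck_fst]

omit hr in
theorem IsLift.comp {F : ℝ → PathCover x₀} (hF : IsLift hL r F) {φ : ℝ → ℝ} (hφ : Continuous φ) :
    IsLift hL r (F ∘ φ) :=
  ⟨hF.continuous_fst.comp hφ, fun t₀ => hφ.continuousAt.eventually (hF.eventually_eq (φ t₀))⟩

omit hr in
theorem FreeClass.comp_add {α : Path.Homotopic.Quotient x₀ x₀} {f : ℝ → M}
    (hf : FreeClass hL r α f) (s : ℝ) : FreeClass hL r α fun t => f (t + s) := by
  obtain ⟨F, hF, h, hp⟩ := hf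
  refine ⟨_, hF.comp (continuous_add_const s), fun t => h _, fun t => ?_⟩
  simp only [Function.comp]
  rw [← hp]
  exact congrArg F (by ring)

/-- Curves uniformly closer than `r` are freely homotopic: the lift of `f` is pushed to `g`
pointwise by short steps, which commute with deck transformations and so keep the equivariance. -/
theorem FreeClass.of_dist_lt {α : Path.Homotopic.Quotient x₀ x₀} {f g : ℝ → M}
    (hf : FreeClass hL r α f) (hg : Continuous g) (hgp : Function.Periodic g 1)
    (hfg : ∀ t, dist (f t) (g t) < r) : FreeClass hL r α g := by
  obtain ⟨F, hF, hFf, hp⟩ := hf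
  have hfc : Continuous f := hF.continuous_fst.congr hFf
  refine ⟨fun t => step hL r (F t) (g t), ⟨hg, fun t₀ => ?_⟩, fun t => rfl, fun t => ?_⟩
  -- The step from `F t₀` to the point over `g t` is factored in two ways, through `f t` and through
  -- `g t₀`.
  · have h1 : ∀ᶠ t in 𝓝 t₀, dist (f t₀) (f t) + dist (f t) (g t) < r := by
      have hc : Continuous fun t => dist (f t₀) (f t) + dist (f t) (g t) := by fun_prop
      exact hc.continuousAt.eventually_lt continuousAt_const (by simpa using hfg t₀)
    have h2 : ∀ᶠ t in 𝓝 t₀, dist (f t₀) (g t₀) + dist (g t₀) (g t) < r := by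
      have hc : Continuous fun t => dist (f t₀) (g t₀) + dist (g t₀) (g t) := by fun_prop
      exact hc.continuousAt.eventually_lt continuousAt_const (by simpa using hfg t₀)
    filter_upwards [hF.eventually_eq t₀, h1, h2] with t e h1 h2
    rw [step_step hL hr (by rwa [hFf]), e, hFf, step_step hL hr (by rwa [hFf])]
    rfl
  · simp only
    rw [hp, hgp, step_deck]

end Lifts

/-- Lipschitz curves on consecutive unit intervals glue. -/
theorem lipschitzWith_glue_floor {M : Type*} [MetricSpace M] {K : ℝ≥0} (g : ℤ → ℝ → M)
    (hg : ∀ i, LipschitzOnWith K (g i) (Icc 0 1)) (hglue : ∀ i, g i 1 = g (i + 1) 0) :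
    LipschitzWith K fun t => g ⌊t⌋ (Int.fract t) := by
  have h0 : ∀ i j : ℤ, i ≤ j → dist (g i 0) (g j 0) ≤ K * (j - i : ℝ) := by
    intro i j hij
    induction j, hij using Int.leInduction with
    | base => simp
    | succ j _ ih =>
      have h1 := (hg j).dist_le_mul 0 (by simp) 1 (by simp)
      rw [hglue] at h1
      have h2 := dist_triangle (g i 0) (g j 0) (g (j + 1) 0)
      simp only [dist_zero_left, norm_one] at h1
      push_cast
      linarith
  have hfr (t : ℝ) : Int.fract t ∈ Icc (0 : ℝ) 1 := ⟨Int.fract_nonneg t, (Int.fract_lt_one t).le⟩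
  have key : ∀ s t : ℝ, s ≤ t →
      dist (g ⌊s⌋ (Int.fract s)) (g ⌊t⌋ (Int.fract t)) ≤ K * (t - s) := by
    intro s t hst
    have es := Int.floor_add_fract s
    have et := Int.floor_add_fract t
    rcases (Int.floor_mono hst).eq_or_lt with h | h
    · rw [h] at es ⊢
      have h1 := (hg ⌊t⌋).dist_le_mul _ (hfr s) _ (hfr t)
      rw [Real.dist_eq, abs_sub_comm, abs_of_nonneg (by linarith)] at h1
      convert h1 using 2
      linarith
    · have h1 := (hg ⌊s⌋).dist_le_mul _ (hfr s) 1 (by simp)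
      rw [Real.dist_eq, abs_sub_comm, abs_of_nonneg (by linarith [(hfr s).2]), hglue] at h1
      have h2 := h0 _ _ (Int.add_one_le_iff.2 h)
      have h3 := (hg ⌊t⌋).dist_le_mul 0 (by simp) _ (hfr t)
      rw [Real.dist_eq, zero_sub, abs_neg, abs_of_nonneg (hfr t).1] at h3
      have h4 := dist_triangle4 (g ⌊s⌋ (Int.fract s)) (g (⌊s⌋ + 1) 0) (g ⌊t⌋ 0)
        (g ⌊t⌋ (Int.fract t))
      push_cast at h2
      calc _ ≤ _ := h4
        _ ≤ K * (1 - Int.fract s) + K * ((⌊t⌋ : ℝ) - (⌊s⌋ + 1)) + K * Int.fract t := by linarith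
        _ = K * ((⌊t⌋ + Int.fract t) - (⌊s⌋ + Int.fract s)) := by ring
        _ = K * (t - s) := by rw [es, et]
  refine LipschitzWith.of_dist_le_mul fun s t => ?_
  rcases le_total s t with h | h
  · rw [Real.dist_eq, abs_sub_comm, abs_of_nonneg (sub_nonneg.2 h)]
    exact key s t h
  · rw [Real.dist_eq, abs_of_nonneg (sub_nonneg.2 h), dist_comm]
    exact key t s h

/-! ### Chains in the universal cover -/

section Chains

variable {M : Type*} [MetricSpace M] {x₀ : M} {r : ℝ}

/-- `b` is reached from `a` in the universal cover by `m` steps of length less than `ρ`. -/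
def Chain (hL : LipschitzJoined M) (r ρ : ℝ) (m : ℕ) (a b : PathCover x₀) : Prop :=
  ∃ y : ℕ → PathCover x₀, y 0 = a ∧ y m = b ∧
    ∀ i < m, dist (y i).1 (y (i + 1)).1 < ρ ∧ y (i + 1) = step hL r (y i) (y (i + 1)).1

variable {hL : LipschitzJoined M} {ρ : ℝ}

theorem Chain.refl (a : PathCover x₀) : Chain hL r ρ 0 a a :=
  ⟨fun _ => a, rfl, rfl, fun i hi => absurd hi (Nat.not_lt_zero i)⟩

theorem Chain.trans {m k : ℕ} {a b c : PathCover x₀} (h : Chain hL r ρ m a b)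
    (h' : Chain hL r ρ k b c) : Chain hL r ρ (m + k) a c := by
  obtain ⟨y, y0, ym, hy⟩ := h
  obtain ⟨z, z0, zk, hz⟩ := h'
  have h2 : ∀ i, (if m + i ≤ m then y (m + i) else z (m + i - m)) = z i := by
    intro i
    split_ifs with h
    · obtain rfl : i = 0 := by omega
      rw [add_zero, ym, z0]
    · rw [Nat.add_sub_cancel_left]
  refine ⟨fun i => if i ≤ m then y i else z (i - m), by simpa using y0, ?_, fun i hi => ?_⟩
  · simp only [h2, zk]
  · rcases lt_or_ge i m with h | h
    · simp only [if_pos h.le, if_pos (Nat.succ_le_of_lt h)]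
      exact hy i h
    · obtain ⟨j, rfl⟩ := Nat.exists_eq_add_of_le h
      simp only [add_assoc, h2]
      exact hz j (by omega)

theorem Chain.deck {m : ℕ} {a b : PathCover x₀} (h : Chain hL r ρ m a b)
    (α : Path.Homotopic.Quotient x₀ x₀) : Chain hL r ρ m (deck α a) (deck α b) := by
  obtain ⟨y, y0, ym, hy⟩ := h
  refine ⟨fun i => PathCover.deck α (y i), congrArg _ y0, congrArg _ ym,
    fun i hi => ⟨(hy i hi).1, ?_⟩⟩
  simp only [deck_fst, step_deck]
  rw [← (hy i hi).2]

variable (hr : SmallPathsHomotopic M r)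
include hr

theorem IsLift.chain (h : 0 < r) (hρ : ρ ≤ r) {F : ℝ → PathCover x₀} (hF : IsLift hL r F) {m : ℕ}
    (hm : 0 < m)
    (hd : ∀ s ∈ Icc (0 : ℝ) 1, ∀ t ∈ Icc (0 : ℝ) 1, |s - t| ≤ 1 / m → dist (F s).1 (F t).1 < ρ) :
    Chain hL r ρ m (F 0) (F 1) := by
  have hm' : (0 : ℝ) < m := Nat.cast_pos.2 hm
  have hmem : ∀ i : ℕ, i ≤ m → (i / m : ℝ) ∈ Icc (0 : ℝ) 1 := fun i hi =>
    ⟨by positivity, (div_le_one hm').2 (Nat.cast_le.2 hi)⟩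
  refine ⟨fun i => F (i / m), by simp, by simp [div_self hm'.ne'], fun i hi => ?_⟩
  have e : ((i + 1 : ℕ) / m : ℝ) - i / m = 1 / m := by
    push_cast
    ring
  refine ⟨hd _ (hmem i hi.le) _ (hmem _ hi) ?_, hF.eq_step hr h fun t ht => ?_⟩
  · rw [abs_sub_comm, e, abs_of_nonneg (by positivity)]
  · refine (hd _ ?_ _ (hmem i hi.le) ?_).trans_le hρ
    · exact (convex_Icc (0 : ℝ) 1).ordConnected.uIcc_subset (hmem i hi.le) (hmem _ hi) ht
    · refine (abs_sub_left_of_mem_uIcc ht).trans ?_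
      rw [e, abs_of_nonneg (by positivity)]

/-- Every loop class is realized by a chain. -/
theorem exists_chain_deck (h : 0 < r) (hρ : 0 < ρ) (hρr : ρ ≤ r)
    (α : Path.Homotopic.Quotient x₀ x₀) :
    ∃ m, Chain hL r ρ m (base x₀) (PathCover.deck α (base x₀)) := by
  obtain ⟨γ, rfl⟩ := Path.Homotopic.Quotient.mk_surjective α
  have hc : Continuous γ.extend := γ.continuous_extend
  obtain ⟨u, hu0, hu1⟩ := exists_mk_pathOn_eq γ.extend hc γ (fun t => by simp)
    (Path.Homotopic.Quotient.refl x₀)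
  have hF := isLift_pathOn (hL := hL) hr h γ.extend hc 0 u
  have huc := (isCompact_Icc (a := (0 : ℝ)) (b := 1)).uniformContinuousOn_of_continuous
    hc.continuousOn
  obtain ⟨δ, hδ, hd⟩ := Metric.uniformContinuousOn_iff.1 huc ρ hρ
  obtain ⟨m, hm⟩ := exists_nat_one_div_lt hδ
  have := hF.chain hr h hρr (m := m + 1) (Nat.succ_pos m) fun s hs t ht hst =>
    hd s hs t ht (lt_of_le_of_lt hst (by exact_mod_cast hm))
  simp only [mk_pathOn_self, Path.Homotopic.Quotient.trans_refl] at this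
  rw [hu0, hu1] at this
  refine ⟨m + 1, ?_⟩
  convert this using 1 <;>
  simp [base, PathCover.deck]

/-- The chain is continued equivariantly to all integers and its vertices are joined by
`ρ`-Lipschitz edges. The result has period `m`; rescaling the period to `1` multiplies the constant
by `m`. -/
theorem Chain.exists_freeClass {ρ : ℝ≥0} (hρr : 5 * (ρ : ℝ) ≤ r) (hρ : 0 < ρ) {m : ℕ} (hm : 0 < m)
    {a : PathCover x₀} (α : FundamentalGroup M x₀)
    (hch : Chain hL r ρ m a (PathCover.deck α.toPath a)) :
    ∃ f : ℝ → M, LipschitzWith (m * ρ) f ∧ FreeClass hL r α.toPath f := by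
  obtain ⟨y, y0, ym, hy⟩ := hch
  have hmz : (m : ℤ) ≠ 0 := by omega
  have hmR : (m : ℝ) ≠ 0 := by exact_mod_cast hm.ne'
  let z : ℤ → PathCover x₀ := fun i =>
    PathCover.deck (FundamentalGroup.toPath (α ^ (i / (m : ℤ)))) (y (i % m).toNat)
  have zper : ∀ i, z (i + m) = PathCover.deck α.toPath (z i) := by
    intro i
    simp only [z]
    rw [← deck_trans, Int.add_emod_right, Int.add_ediv_of_dvd_right (dvd_refl _), Int.ediv_self hmz,
      zpow_add_one, FundamentalGroup.mul_def]
  have zsucc : ∀ i, z (i + 1) = PathCover.deck (FundamentalGroup.toPath (α ^ (i / (m : ℤ))))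
      (y ((i % m).toNat + 1)) := by
    intro i
    have h1 := Int.emod_nonneg i hmz
    have h2 := Int.emod_lt_of_pos i (by omega : (0 : ℤ) < m)
    have h3 := Int.mul_ediv_add_emod i m
    simp only [z]
    by_cases hj : i % m + 1 < m
    · have hd : (i + 1) / (m : ℤ) = i / m := by
        rw [Int.ediv_eq_iff_of_pos (by omega)]
        constructor <;> nlinarith
      have he : (i + 1) % (m : ℤ) = i % m + 1 := by
        have := Int.mul_ediv_add_emod (i + 1) m
        rw [hd] at this
        linarith
      rw [hd, he, Int.toNat_add h1 zero_le_one]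
      rfl
    · have hd : (i + 1) / (m : ℤ) = i / m + 1 := by
        rw [Int.ediv_eq_iff_of_pos (by omega)]
        constructor <;> nlinarith
      have he : (i + 1) % (m : ℤ) = 0 := by
        have := Int.mul_ediv_add_emod (i + 1) m
        rw [hd] at this
        linarith
      have hm1 : (i % m).toNat + 1 = m := by omega
      -- A product in `FundamentalGroup` concatenates in the reverse order, so `α` has to be
      -- commuted past its power here.
      rw [hd, he, hm1, ym, Int.toNat_zero, y0, ← deck_trans, zpow_add_one,
        ← (Commute.self_zpow α _).eq, FundamentalGroup.mul_def]
  have hz : ∀ i, dist (z i).1 (z (i + 1)).1 < ρ ∧ z (i + 1) = step hL r (z i) (z (i + 1)).1 := by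
    intro i
    have h1 := Int.emod_nonneg i hmz
    have h2 := Int.emod_lt_of_pos i (by omega : (0 : ℤ) < m)
    obtain ⟨hy1, hy2⟩ := hy (i % m).toNat (by omega)
    rw [zsucc]
    refine ⟨hy1, ?_⟩
    simp only [z]
    rw [step_deck, deck_fst, ← hy2]
  have hex : ∀ x y : M, ∃ e : ℝ → M, dist x y < ρ → LipschitzWith ρ e ∧ e 0 = x ∧ e 1 = y := by
    intro x y
    by_cases hxy : dist x y < ρ
    · obtain ⟨e, he⟩ := hL x y ρ hxy
      exact ⟨e, fun _ => he⟩
    · exact ⟨fun _ => x, fun h => absurd h hxy⟩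
  choose E hE using hex
  let e : ℤ → ℝ → M := fun i => E (z i).1 (z (i + 1)).1
  have he : ∀ i, LipschitzWith ρ (e i) := fun i => (hE _ _ (hz i).1).1
  have he0 : ∀ i, e i 0 = (z i).1 := fun i => (hE _ _ (hz i).1).2.1
  have he1 : ∀ i, e i 1 = (z (i + 1)).1 := fun i => (hE _ _ (hz i).1).2.2
  let f : ℝ → M := fun t => e ⌊t⌋ (Int.fract t)
  have hfL : LipschitzWith ρ f := lipschitzWith_glue_floor e (fun i => (he i).lipschitzOnWith)
    fun i => by rw [he1, he0]
  have hfper : ∀ t, f (t + m) = f t := by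
    intro t
    have hfl : ⌊t + m⌋ = ⌊t⌋ + (m : ℤ) := by exact_mod_cast Int.floor_add_natCast t m
    have hzf : ∀ i, (z (i + m)).1 = (z i).1 := fun i => by rw [zper, deck_fst]
    simp only [f, e]
    rw [hfl, Int.fract_add_natCast, hzf, show ⌊t⌋ + (m : ℤ) + 1 = ⌊t⌋ + 1 + m by ring, hzf]
  have hr0 : (0 : ℝ) < ρ := hρ
  have hfz : ∀ t, dist (z ⌊t⌋).1 (f t) ≤ ρ := by
    intro t
    have h1 := (he ⌊t⌋).dist_le_mul 0 (Int.fract t)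
    rw [he0, Real.dist_eq, zero_sub, abs_neg, abs_of_nonneg (Int.fract_nonneg t)] at h1
    exact h1.trans (mul_le_of_le_one_right hr0.le (Int.fract_lt_one t).le)
  let F : ℝ → PathCover x₀ := fun t => step hL r (z ⌊t⌋) (f t)
  have hF : IsLift hL r F := by
    refine ⟨hfL.continuous, fun t₀ => ?_⟩
    -- The interval reaches one unit to the left because `t₀` may be an integer, where the base
    -- vertex of `F` changes.
    have hIoo : Ioo ((⌊t₀⌋ : ℝ) - 1) (⌊t₀⌋ + 1) ∈ 𝓝 t₀ :=
      Ioo_mem_nhds (by linarith [Int.floor_le t₀]) (Int.lt_floor_add_one t₀)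
    filter_upwards [hIoo] with t ht
    have hz0 := hfz t₀
    have hzt := hfz t
    have hcase : F t = step hL r (z ⌊t₀⌋) (f t) ∧ dist (z ⌊t₀⌋).1 (f t) ≤ 2 * ρ := by
      have h1 : ⌊t₀⌋ - 1 ≤ ⌊t⌋ := Int.le_floor.2 (by push_cast; exact ht.1.le)
      have h2 : ⌊t⌋ < ⌊t₀⌋ + 1 := Int.floor_lt.2 (by push_cast; exact ht.2)
      rcases (show ⌊t⌋ = ⌊t₀⌋ ∨ ⌊t₀⌋ = ⌊t⌋ + 1 by omega) with h | h
      · refine ⟨by simp only [F, h], ?_⟩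
        rw [← h]
        linarith
      · obtain ⟨hz1, hz2⟩ := hz ⌊t⌋
        have hd : dist (z (⌊t⌋ + 1)).1 (f t) ≤ 2 * ρ := by
          have := dist_triangle_left (z (⌊t⌋ + 1)).1 (f t) (z ⌊t⌋).1
          linarith
        rw [h]
        refine ⟨?_, hd⟩
        rw [hz2, step_step hL hr (by linarith)]
    have h3 := dist_triangle_left (f t₀) (f t) (z ⌊t₀⌋).1
    refine hcase.1.trans ?_
    simp only [F, step_fst]
    -- The detour from the vertex via `f t₀` to `f t` has length at most `ρ + 3ρ`, which is less
    -- than `5ρ ≤ r`.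
    rw [step_step hL hr (by linarith)]
  have hFper : ∀ t, F (t + m) = PathCover.deck α.toPath (F t) := by
    intro t
    simp only [F]
    rw [hfper, ← step_deck, ← zper]
    congr 2
    exact_mod_cast Int.floor_add_natCast t m
  refine ⟨fun t => f (m * t), ?_, _, hF.comp (continuous_const_mul (m : ℝ)), fun t => rfl,
    fun t => ?_⟩
  · rw [mul_comm]
    refine hfL.comp (LipschitzWith.of_dist_le_mul fun s t => ?_)
    rw [Real.dist_eq, ← mul_sub, abs_mul, Nat.abs_cast]
    rfl
  · simp only [Function.comp]
    rw [← hFper, mul_add, mul_one]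

end Chains

/-! ### Curves of least Lipschitz constant in a free homotopy class -/

section Minimization

variable {M : Type*} [MetricSpace M] {x₀ : M} {r : ℝ} {hL : LipschitzJoined M}

/-- Lipschitz control makes closeness at finitely many times uniform: each curve moves less than `δ`
from `t` to the grid point below it. -/
theorem Function.Periodic.dist_lt_of_grid {f g : ℝ → M} {K : ℝ≥0} (hf : LipschitzWith K f)
    (hg : LipschitzWith K g) (hfp : Function.Periodic f 1) (hgp : Function.Periodic g 1)
    {N : ℕ} (hN : 0 < N) {δ : ℝ} (hK : K / N < δ)
    (hfg : ∀ i ∈ Finset.range N, dist (f (i / N)) (g (i / N)) < δ) (t : ℝ) :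
    dist (f t) (g t) < 3 * δ := by
  have hN' : (0 : ℝ) < N := Nat.cast_pos.2 hN
  have e1 : ∀ {φ : ℝ → M}, Function.Periodic φ 1 → φ (Int.fract t) = φ t := by
    intro φ hφ
    have := hφ.sub_int_mul_eq ⌊t⌋ (x := t)
    rwa [mul_one] at this
  rw [← e1 hfp, ← e1 hgp]
  set s := Int.fract t
  have hs0 : 0 ≤ s := Int.fract_nonneg t
  have hs1 : s < 1 := Int.fract_lt_one t
  set i := ⌊N * s⌋₊
  have hi : i ∈ Finset.range N := by
    rw [Finset.mem_range, Nat.floor_lt (by positivity)]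
    exact mul_lt_of_lt_one_right hN' hs1
  have h1 : (i : ℝ) ≤ N * s := Nat.floor_le (by positivity)
  have h2 : N * s < i + 1 := Nat.lt_floor_add_one _
  have h3 : dist s (i / N) ≤ 1 / N := by
    rw [Real.dist_eq, abs_of_nonneg (sub_nonneg.2 ((div_le_iff₀' hN').2 h1)), sub_le_iff_le_add,
      ← add_div, le_div_iff₀' hN']
    linarith
  have h4 : ∀ {φ : ℝ → M}, LipschitzWith K φ → dist (φ s) (φ (i / N)) < δ := by
    intro φ hφ
    refine (hφ.dist_le_mul _ _).trans_lt (lt_of_le_of_lt ?_ hK)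
    rw [div_eq_mul_one_div (K : ℝ)]
    exact mul_le_mul_of_nonneg_left h3 K.2
  have h5 := dist_triangle4 (f s) (f (i / N)) (g (i / N)) (g s)
  have h6 := h4 hf
  have h7 := h4 hg
  rw [dist_comm] at h7
  linarith [hfg i hi]

/-- Closedness is in the topology of pointwise convergence. A limit is close on a finite grid to
some member, hence uniformly closer than `r` to it, hence in the same class. Since `ℝ → M` is
compact for compact `M`, Tychonoff can then play the part of Arzelà–Ascoli. -/
theorem isClosed_lipschitz_freeClass (hr : SmallPathsHomotopic M r) (h : 0 < r)
    (α : Path.Homotopic.Quotient x₀ x₀) (K : ℝ≥0) :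
    IsClosed {f : ℝ → M | LipschitzWith K f ∧ FreeClass hL r α f} := by
  refine isClosed_of_closure_subset fun f hf => ?_
  have hfL : LipschitzWith K f :=
    closure_minimal (fun g hg => hg.1) (isClosed_setOfPred_lipschitzWith K) hf
  have hcl : IsClosed {g : ℝ → M | ∀ t, g (t + 1) = g t} := by
    simp only [ofPred_forall]
    exact isClosed_iInter fun t => isClosed_eq (continuous_apply _) (continuous_apply _)
  have hfp : Function.Periodic f 1 := closure_minimal (fun g hg => hg.2.periodic) hcl hf
  obtain ⟨N, hN⟩ := exists_nat_gt (K / (r / 3))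
  have hN0 : (0 : ℝ) < N := lt_of_le_of_lt (by positivity) hN
  have hopen : IsOpen {g : ℝ → M | ∀ i ∈ Finset.range N, dist (g (i / N)) (f (i / N)) < r / 3} := by
    simp only [ofPred_forall]
    exact isOpen_biInter_finset fun i _ =>
      isOpen_lt ((continuous_apply _).dist continuous_const) continuous_const
  obtain ⟨g, hg, hgL, hgF⟩ := mem_closure_iff.1 hf _ hopen (fun i _ => by simpa using h)
  refine ⟨hfL, hgF.of_dist_lt hr hfL.continuous hfp fun t => ?_⟩
  have := Function.Periodic.dist_lt_of_grid hgL hfL hgF.periodic hfp (Nat.cast_pos.1 hN0)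
    (δ := r / 3) (by rwa [div_lt_iff₀ hN0, ← div_lt_iff₀' (by positivity)]) hg t
  linarith

/-- A free homotopy class that contains Lipschitz curves contains one with the least constant. -/
theorem exists_minimal_freeClass [CompactSpace M] (hr : SmallPathsHomotopic M r) (h : 0 < r)
    (α : Path.Homotopic.Quotient x₀ x₀)
    {K₀ : ℝ≥0} {f₀ : ℝ → M} (hf₀ : LipschitzWith K₀ f₀) (hF₀ : FreeClass hL r α f₀) :
    ∃ (K : ℝ≥0) (f : ℝ → M), K ≤ K₀ ∧ LipschitzWith K f ∧ FreeClass hL r α f ∧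
      ∀ (K' : ℝ≥0) (f' : ℝ → M), LipschitzWith K' f' → FreeClass hL r α f' → K ≤ K' := by
  let A : ℝ≥0 → Set (ℝ → M) := fun K => {f | LipschitzWith K f ∧ FreeClass hL r α f}
  let T : Set ℝ≥0 := {K | (A K).Nonempty}
  have hT : T.Nonempty := ⟨K₀, f₀, hf₀, hF₀⟩
  have : Nonempty T := hT.to_subtype
  have hmono : Monotone A := fun K K' hKK f hf => ⟨hf.1.weaken hKK, hf.2⟩
  obtain ⟨f, hf⟩ := IsCompact.nonempty_iInter_of_directed_nonempty_isCompact_isClosed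
    (fun K : T => A K)
    (fun K K' => ⟨min K K', hmono (min_le_left (K : ℝ≥0) K'), hmono (min_le_right (K : ℝ≥0) K')⟩)
    (fun K => K.2) (fun K => (isClosed_lipschitz_freeClass hr h α K).isCompact)
    fun K => isClosed_lipschitz_freeClass hr h α K
  rw [mem_iInter] at hf
  refine ⟨sInf T, f, csInf_le (OrderBot.bddBelow T) ⟨f₀, hf₀, hF₀⟩, ?_, (hf ⟨K₀, f₀, hf₀, hF₀⟩).2,
    fun K' f' h1 h2 => csInf_le (OrderBot.bddBelow T) ⟨f', h1, h2⟩⟩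
  -- The curve is `K`-Lipschitz for every admissible `K`; letting `K` tend to the infimum shows that
  -- the infimum is attained.
  refine LipschitzWith.of_dist_le_mul fun s t => ?_
  have hlim : ∀ K ∈ T, dist (f s) (f t) ≤ K * dist s t := fun K hK =>
    (hf ⟨K, hK⟩).1.dist_le_mul s t
  refine le_of_forall_pos_le_add fun ε hε => ?_
  have hpos : 0 < ε / (dist s t + 1) := div_pos hε (by positivity)
  obtain ⟨K, hK, hlt⟩ := exists_lt_of_csInf_lt hT
    (lt_add_of_pos_right (sInf T) (show (0 : ℝ≥0) < ⟨_, hpos.le⟩ from hpos))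
  have hlt' : (K : ℝ) < (sInf T : ℝ≥0) + ε / (dist s t + 1) := hlt
  have h1 := hlim K hK
  have h2 : (K : ℝ) * dist s t ≤ ((sInf T : ℝ≥0) + ε / (dist s t + 1)) * dist s t :=
    mul_le_mul_of_nonneg_right hlt'.le dist_nonneg
  have h3 : ε / (dist s t + 1) * dist s t ≤ ε := by
    rw [div_mul_eq_mul_div, div_le_iff₀ (by positivity)]
    nlinarith [dist_nonneg (x := s) (y := t)]
  rw [add_mul] at h2
  linarith

theorem lipschitzOnWith_Icc_union {K : ℝ≥0} {f : ℝ → M} {a b c : ℝ}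
    (h1 : LipschitzOnWith K f (Icc a b)) (h2 : LipschitzOnWith K f (Icc b c)) :
    LipschitzOnWith K f (Icc a c) := by
  have key : ∀ s ∈ Icc a c, ∀ t ∈ Icc a c, s ≤ t → dist (f s) (f t) ≤ K * dist s t := by
    intro s hs t ht hst
    rcases le_total t b with h | h
    · exact h1.dist_le_mul s ⟨hs.1, hst.trans h⟩ t ⟨ht.1, h⟩
    · rcases le_total b s with h' | h'
      · exact h2.dist_le_mul s ⟨h', hs.2⟩ t ⟨h, ht.2⟩
      · have e1 := h1.dist_le_mul s ⟨hs.1, h'⟩ b ⟨hs.1.trans h', le_rfl⟩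
        have e2 := h2.dist_le_mul b ⟨le_rfl, h.trans ht.2⟩ t ⟨h, ht.2⟩
        rw [Real.dist_eq, abs_sub_comm, abs_of_nonneg (by linarith)] at e1 e2 ⊢
        linarith [dist_triangle (f s) (f b) (f t)]
  refine LipschitzOnWith.of_dist_le_mul fun s hs t ht => ?_
  rcases le_total s t with h | h
  · exact key s hs t ht h
  · rw [dist_comm (f s), dist_comm s]
    exact key t ht s hs h

/-- Replacing the part of a closed curve over `[0, δ]` by a shorter one lowers the Lipschitz
constant. -/
theorem exists_shortcut (hL : LipschitzJoined M) {f : ℝ → M} {K : ℝ≥0} (hf : LipschitzWith K f)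
    (hfp : Function.Periodic f 1) {δ : ℝ} (hδ : 0 < δ) (hδ1 : δ ≤ 1 / 2)
    (hlt : dist (f 0) (f δ) < K * δ) :
    ∃ (K' : ℝ≥0) (g : ℝ → M), K' < K ∧ LipschitzWith K' g ∧ Function.Periodic g 1 ∧
      ∀ t, dist (f t) (g t) ≤ 3 * (K * δ) := by
  obtain ⟨Λ, hΛ1, hΛ2⟩ := exists_between hlt
  have hΛ0 : 0 < Λ := dist_nonneg.trans_lt hΛ1
  lift Λ to ℝ≥0 using hΛ0.le
  obtain ⟨e, he, he0, he1⟩ := hL _ _ Λ hΛ1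
  have hK : (0 : ℝ) < K := pos_of_mul_pos_left (hΛ0.trans hΛ2) hδ.le
  have hL1 : 0 < K * (1 - δ) := mul_pos hK (by linarith)
  -- Bound for the length after the replacement. The new curve is run with constant `L`: the
  -- shortcut takes time `c = Λ / L`, and `ψ` maps the remaining `[c, 1]` affinely onto `[δ, 1]`.
  set L := K * (1 - δ) + Λ with hLdef
  have hLpos : 0 < L := by linarith
  have hLK : L < K := by linarith
  set c := Λ / L with hc
  have hc0 : 0 < c := div_pos hΛ0 hLpos
  have hcL : c * L = Λ := div_mul_cancel₀ _ hLpos.ne'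
  have hc1 : (1 - c) * L = K * (1 - δ) := by
    rw [sub_mul, hcL]
    linarith
  have hc1' : 0 < 1 - c := pos_of_mul_pos_left (hc1 ▸ hL1) hLpos.le
  -- From `Λ < K δ` and `L > K / 2`, the latter since `δ ≤ 1 / 2`. It keeps the reparametrized curve
  -- within `3 K δ` of the old one.
  have hcδ : c ≤ 2 * δ := by
    rw [hc, div_le_iff₀ hLpos]
    nlinarith
  let ψ : ℝ → ℝ := fun t => δ + (t - c) * ((1 - δ) / (1 - c))
  let φ : ℝ → M := fun t => if t ≤ c then e (t / c) else f (ψ t)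
  have hψ1 : ψ 1 = 1 := by
    simp only [ψ]
    field_simp
    ring
  have hψc : ψ c = δ := by simp [ψ]
  have hφ1 : ∀ t, t ≤ c → φ t = e (t / c) := fun t ht => if_pos ht
  have hφ2 : ∀ t, c ≤ t → φ t = f (ψ t) := by
    intro t ht
    rcases ht.eq_or_lt with rfl | h
    · rw [hφ1 c le_rfl, div_self hc0.ne', he1, hψc]
    · exact if_neg h.not_ge
  have hφL : LipschitzOnWith ⟨L, hLpos.le⟩ φ (Icc 0 1) := by
    refine lipschitzOnWith_Icc_union (b := c) ?_ ?_
    · refine LipschitzOnWith.of_dist_le_mul fun s hs t ht => ?_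
      rw [hφ1 s hs.2, hφ1 t ht.2]
      refine (he.dist_le_mul _ _).trans_eq ?_
      rw [Real.dist_eq, Real.dist_eq, ← _root_.sub_div, abs_div, abs_of_pos hc0, ← hcL]
      change c * L * (|s - t| / c) = L * |s - t|
      field_simp
    · refine LipschitzOnWith.of_dist_le_mul fun s hs t ht => ?_
      rw [hφ2 s hs.1, hφ2 t ht.1]
      refine (hf.dist_le_mul _ _).trans_eq ?_
      have hd : (0 : ℝ) < 1 - δ := by linarith
      have : ψ s - ψ t = (s - t) * ((1 - δ) / (1 - c)) := by
        simp only [ψ]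
        ring
      rw [Real.dist_eq, Real.dist_eq, this, abs_mul, abs_of_pos (div_pos hd hc1')]
      change (K : ℝ) * (|s - t| * ((1 - δ) / (1 - c))) = L * |s - t|
      field_simp
      linear_combination -|s - t| * hc1
  have hφ01 : φ 1 = φ 0 := by
    rw [hφ2 1 (by linarith), hψ1, hφ1 0 hc0.le, zero_div, he0]
    simpa using hfp 0
  refine ⟨⟨L, hLpos.le⟩, fun t => φ (Int.fract t), hLK,
    lipschitzWith_glue_floor (fun _ => φ) (fun _ => hφL) (fun _ => hφ01), fun t => ?_, fun t => ?_⟩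
  · simp only [Int.fract_add_one]
  · have e1 : f (Int.fract t) = f t := by
      have := hfp.sub_int_mul_eq ⌊t⌋ (x := t)
      rwa [mul_one] at this
    rw [← e1]
    have hs0 : 0 ≤ Int.fract t := Int.fract_nonneg t
    have hs1 : Int.fract t < 1 := Int.fract_lt_one t
    simp only
    generalize Int.fract t = s at hs0 hs1 ⊢
    rcases le_total s c with h | h
    · rw [hφ1 s h]
      have h1 := hf.dist_le_mul s 0
      have h2 := he.dist_le_mul 0 (s / c)
      have h3 : s / c ≤ 1 := (div_le_one hc0).2 h
      have h4 : 0 ≤ s / c := div_nonneg hs0 hc0.le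
      rw [Real.dist_eq, sub_zero, abs_of_nonneg hs0] at h1
      rw [he0, Real.dist_eq, zero_sub, abs_neg, abs_of_nonneg h4] at h2
      have h5 : (Λ : ℝ) * (s / c) ≤ Λ := mul_le_of_le_one_right hΛ0.le h3
      have h6 : (K : ℝ) * s ≤ K * (2 * δ) := mul_le_mul_of_nonneg_left (h.trans hcδ) hK.le
      linarith [dist_triangle (f s) (f 0) (e (s / c))]
    · rw [hφ2 s h]
      refine (hf.dist_le_mul _ _).trans ?_
      have h1 : s - ψ s = (c - δ) * ((1 - s) / (1 - c)) := by
        simp only [ψ]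
        field_simp
        ring
      have h2 : (1 - s) / (1 - c) ≤ 1 := (div_le_one hc1').2 (by linarith)
      have h3 : 0 ≤ (1 - s) / (1 - c) := div_nonneg (by linarith) hc1'.le
      have h4 : |c - δ| ≤ 3 * δ := abs_le.2 ⟨by linarith, by linarith⟩
      have h5 : dist s (ψ s) ≤ 3 * δ := by
        rw [Real.dist_eq, h1, abs_mul, abs_of_nonneg h3]
        exact (mul_le_of_le_one_right (abs_nonneg _) h2).trans h4
      have := mul_le_mul_of_nonneg_left h5 hK.le
      linarith

/-- A curve of least Lipschitz constant in its free homotopy class has constant speed locally. -/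
theorem dist_eq_of_minimal (hr : SmallPathsHomotopic M r)
    {α : Path.Homotopic.Quotient x₀ x₀} {f : ℝ → M} {K : ℝ≥0} (hf : LipschitzWith K f)
    (hF : FreeClass hL r α f)
    (hmin : ∀ (K' : ℝ≥0) (f' : ℝ → M), LipschitzWith K' f' → FreeClass hL r α f' → K ≤ K')
    {s t : ℝ} (hst : dist s t ≤ 1 / 2) (hKr : 3 * (K * dist s t) < r) :
    dist (f s) (f t) = K * dist s t := by
  wlog h : s < t generalizing s t
  · rcases (not_lt.1 h).eq_or_lt with rfl | h'
    · simp
    · rw [dist_comm s t] at hst hKr ⊢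
      rw [dist_comm (f s)]
      exact this hst hKr h'
  by_contra hne
  have hlt := lt_of_le_of_ne (hf.dist_le_mul s t) hne
  rw [dist_comm s t, Real.dist_eq, abs_of_pos (sub_pos.2 h)] at hst hKr hlt
  -- The parameter is shifted so that the arc to be shortened starts at time `0`.
  have hg : LipschitzWith K fun u => f (u + s) :=
    LipschitzWith.of_dist_le_mul fun u v => by simpa using hf.dist_le_mul (u + s) (v + s)
  obtain ⟨K', g, hK', hgL, hgp, hd⟩ := exists_shortcut hL hg (hF.comp_add s).periodic
    (sub_pos.2 h) hst (by simpa using hlt)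
  exact (hmin K' g hgL ((hF.comp_add s).of_dist_lt hr hgL.continuous hgp
    fun u => (hd u).trans_lt hKr)).not_gt hK'

end Minimization

/-! ### Closed geodesics and loop classes -/

section Geodesics

variable {M : Type*} [MetricSpace M] {x₀ : M} {r : ℝ} {hL : LipschitzJoined M}

theorem ClosedGeodesic.represents_of_lift (hr : SmallPathsHomotopic M r) (h : 0 < r)
    (c : ClosedGeodesic M) (α : FundamentalGroup M x₀) {F : ℝ → PathCover x₀} (hF : IsLift hL r F)
    (hFc : ∀ t, (F t).1 = c.curve (t * c.length)) (hα : F 1 = deck α.toPath (F 0)) :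
    c.Represents α := by
  obtain ⟨p, hp⟩ : ∃ p : Path x₀ (c.curve 0),
      (⟨c.curve 0, Path.Homotopic.Quotient.mk p⟩ : PathCover x₀) = F 0 := by
    have h0 := hFc 0
    rw [zero_mul] at h0
    generalize F 0 = a at h0
    obtain ⟨y, u⟩ := a
    obtain ⟨p, rfl⟩ := Path.Homotopic.Quotient.mk_surjective u
    change y = c.curve 0 at h0
    subst h0
    exact ⟨p, rfl⟩
  refine ⟨p, ?_⟩
  obtain ⟨u, hu0, hu1⟩ := exists_mk_pathOn_eq _ hF.continuous_fst c.loop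
    (fun t => (hFc t).symm) (Path.Homotopic.Quotient.mk p)
  have hu : u = (F 0).2 := eq_of_heq (Sigma.mk.inj (hu0.trans hp)).2
  rw [hu, ← hF.eq_pathOn hr h 0 1, hα, ← hp] at hu1
  have e : α.toPath.trans (Path.Homotopic.Quotient.mk p) =
      (Path.Homotopic.Quotient.mk p).trans (Path.Homotopic.Quotient.mk c.loop) :=
    eq_of_heq (Sigma.mk.inj hu1).2
  rw [Path.Homotopic.Quotient.mk_trans, Path.Homotopic.Quotient.mk_trans, ← e,
    Path.Homotopic.Quotient.mk_symm, Path.Homotopic.Quotient.trans_assoc,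
    Path.Homotopic.Quotient.trans_symm, Path.Homotopic.Quotient.trans_refl]

theorem ClosedGeodesic.Represents.exists_lift (hr : SmallPathsHomotopic M r) (h : 0 < r)
    {c : ClosedGeodesic M} {α : FundamentalGroup M x₀} (hc : c.Represents α) :
    ∃ F : ℝ → PathCover x₀, IsLift hL r F ∧ (∀ t, (F t).1 = c.curve (t * c.length)) ∧
      F 1 = deck α.toPath (F 0) := by
  obtain ⟨p, hp⟩ := hc
  have hcont : Continuous fun t => c.curve (t * c.length) :=
    c.continuous_curve.comp (continuous_mul_const _)
  obtain ⟨u, hu0, hu1⟩ := exists_mk_pathOn_eq (fun t => c.curve (t * c.length)) hcont c.loop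
    (fun t => rfl) (Path.Homotopic.Quotient.mk p)
  refine ⟨_, isLift_pathOn hr h _ hcont 0 u, fun t => rfl, ?_⟩
  simp only [mk_pathOn_self, Path.Homotopic.Quotient.trans_refl]
  rw [hu0, hu1]
  simp only [deck]
  rw [hp, Path.Homotopic.Quotient.mk_trans, Path.Homotopic.Quotient.mk_trans,
    Path.Homotopic.Quotient.mk_symm, Path.Homotopic.Quotient.trans_assoc,
    Path.Homotopic.Quotient.symm_trans, Path.Homotopic.Quotient.trans_refl]

/-- The local isometry condition is propagated along `[s, t]` by continuous induction and the
triangle inequality. -/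
theorem ClosedGeodesic.lipschitzWith (c : ClosedGeodesic M) : LipschitzWith 1 c.curve := by
  have key : ∀ s t : ℝ, s ≤ t → dist (c.curve s) (c.curve t) ≤ t - s := by
    intro s t hst
    have hcl : IsClosed {u | dist (c.curve s) (c.curve u) ≤ u - s} :=
      isClosed_le (continuous_const.dist c.continuous_curve) (by fun_prop)
    have hsub : Icc s t ⊆ {u | dist (c.curve s) (c.curve u) ≤ u - s} := by
      refine (hcl.inter isClosed_Icc).Icc_subset_of_forall_mem_nhdsWithin (by simp) fun u hu => ?_
      obtain ⟨ε, hε, hloc⟩ := c.locally_isometric u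
      filter_upwards [self_mem_nhdsWithin,
        mem_nhdsWithin_of_mem_nhds (Metric.ball_mem_nhds u hε)] with v hv hv'
      have h1 := hloc u (Metric.mem_ball_self hε) v hv'
      rw [dist_comm u, Real.dist_eq, abs_of_nonneg (sub_nonneg.2 (le_of_lt hv))] at h1
      have h2 : dist (c.curve s) (c.curve u) ≤ u - s := hu.1
      have h3 := dist_triangle (c.curve s) (c.curve u) (c.curve v)
      change dist (c.curve s) (c.curve v) ≤ v - s
      linarith
    exact hsub (right_mem_Icc.2 hst)
  refine LipschitzWith.of_dist_le_mul fun s t => ?_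
  rw [NNReal.coe_one, one_mul]
  rcases le_total s t with h | h
  · rw [dist_comm s, Real.dist_eq, abs_of_nonneg (sub_nonneg.2 h)]
    exact key s t h
  · rw [dist_comm (c.curve s), Real.dist_eq, abs_of_nonneg (sub_nonneg.2 h)]
    exact key t s h

theorem ClosedGeodesic.Represents.exists_chain (hr : SmallPathsHomotopic M r) (h : 0 < r) {ρ : ℝ}
    (hρ : 0 < ρ) (hρr : ρ ≤ r) {c : ClosedGeodesic M} {α : FundamentalGroup M x₀}
    (hc : c.Represents α) {m : ℕ} (hm : c.length < m * ρ) :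
    ∃ a : PathCover x₀, Chain hL r ρ m a (deck α.toPath a) := by
  obtain ⟨F, hF, hFc, hα⟩ := hc.exists_lift (hL := hL) hr h
  have hm0 : 0 < (m : ℝ) := pos_of_mul_pos_left (c.length_pos.trans hm) hρ.le
  refine ⟨F 0, hα ▸ hF.chain hr h hρr (Nat.cast_pos.1 hm0) fun s _ t _ hst => ?_⟩
  rw [hFc, hFc]
  refine (c.lipschitzWith.dist_le_mul _ _).trans_lt ?_
  rw [NNReal.coe_one, one_mul, Real.dist_eq, ← _root_.sub_mul, abs_mul, abs_of_pos c.length_pos]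
  calc |s - t| * c.length ≤ 1 / m * c.length := mul_le_mul_of_nonneg_right hst c.length_pos.le
    _ < ρ := by
      rw [one_div, inv_mul_lt_iff₀ hm0]
      exact hm

/-- A closed curve inside a ball of radius `r` lifts to a closed curve, so `α` fixes a point of the
universal cover. -/
theorem ClosedGeodesic.Represents.eq_one (hL : LipschitzJoined M) (hr : SmallPathsHomotopic M r)
    {c : ClosedGeodesic M} {α : FundamentalGroup M x₀} (hc : c.Represents α) (h : c.length < r) :
    α = 1 := by
  have hr0 := c.length_pos.trans h
  obtain ⟨F, hF, hFc, hα⟩ := hc.exists_lift (hL := hL) hr hr0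
  have e := hF.eq_step hr hr0 (a := 0) (b := 1) fun t ht => by
    rw [uIcc_of_le zero_le_one] at ht
    rw [hFc, hFc, zero_mul]
    refine (c.lipschitzWith.dist_le_mul _ _).trans_lt ?_
    rw [NNReal.coe_one, one_mul, dist_zero_right, Real.norm_eq_abs,
      abs_of_nonneg (mul_nonneg ht.1 c.length_pos.le)]
    exact (mul_le_of_le_one_left c.length_pos.le ht.2).trans_lt h
  rw [hα, deck_fst, step_self hL hr hr0] at e
  exact eq_of_deck_eq (e.trans (deck_refl _).symm)

/-- The geodesic is the curve of least Lipschitz constant `K` in the class, slowed to unit speed, so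
that its length is `K`. -/
theorem Chain.exists_closedGeodesic [CompactSpace M] (hr : SmallPathsHomotopic M r) {ρ : ℝ≥0}
    (hρr : 5 * (ρ : ℝ) ≤ r) (hρ : 0 < ρ) {m : ℕ} {a : PathCover x₀} {α : FundamentalGroup M x₀}
    (hα : α ≠ 1) (hch : Chain hL r ρ m a (PathCover.deck α.toPath a)) :
    ∃ c : ClosedGeodesic M, c.Represents α ∧ c.length ≤ m * ρ := by
  have hρ' : (0 : ℝ) < ρ := hρ
  have h : 0 < r := by linarith
  have hdeck : ∀ b : PathCover x₀, PathCover.deck α.toPath b ≠ b := fun b hb =>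
    hα (eq_of_deck_eq (hb.trans (deck_refl b).symm))
  have hm : 0 < m := by
    rcases Nat.eq_zero_or_pos m with rfl | hm
    · obtain ⟨y, y0, ym, -⟩ := hch
      exact absurd (ym.symm.trans y0) (hdeck a)
    · exact hm
  obtain ⟨f₀, hf₀, hF₀⟩ := hch.exists_freeClass hr hρr hρ hm
  obtain ⟨K, f, hK₀, hf, hfree, hmin⟩ := exists_minimal_freeClass hr h α.toPath hf₀ hF₀
  have hfc := hf.continuous
  -- With `K = 0` the curve is constant and so is its lift; then `α` would fix a point.
  have hKpos : (0 : ℝ) < K := by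
    refine lt_of_le_of_ne K.2 fun hK0 => ?_
    obtain ⟨F, hF, hFf, hFp⟩ := hfree
    have hd : ∀ t, (F t).1 = (F 0).1 := by
      intro t
      have := hf.dist_le_mul t 0
      rw [← hK0, zero_mul] at this
      rw [hFf, hFf]
      exact dist_le_zero.1 this
    have e := hF.eq_step hr h (a := 0) (b := 1) fun t _ => by rwa [hd t, dist_self]
    rw [hd 1, step_self hL hr h] at e
    have := hFp 0
    rw [zero_add, e] at this
    exact hdeck _ this.symm
  let c : ClosedGeodesic M :=
    { curve := fun t => f (t / K)
      length := K
      length_pos := hKpos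
      periodic := fun t => by
        simp only [add_div, div_self hKpos.ne']
        exact hfree.periodic _
      locally_isometric := by
        intro t
        -- Two points of the ball are closer than twice its radius: `K / 4` gives parameter distance
        -- at most `1 / 2`, and `r / 6` makes three times the distance less than `r`.
        refine ⟨min (K / 4) (r / 6), lt_min (by positivity) (by positivity), fun s hs s' hs' => ?_⟩
        have h1 := dist_triangle_right s s' t
        have h2 := lt_min_iff.1 (Metric.mem_ball.1 hs)
        have h3 := lt_min_iff.1 (Metric.mem_ball.1 hs')
        have e : dist (s / K) (s' / K) = dist s s' / K := by
          rw [Real.dist_eq, Real.dist_eq, ← _root_.sub_div, abs_div, abs_of_pos hKpos]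
        have e' : K * (dist s s' / K) = dist s s' := mul_div_cancel₀ _ hKpos.ne'
        rw [dist_eq_of_minimal hr hf hfree hmin, e, e']
        · rw [e, div_le_iff₀ hKpos]
          linarith
        · rw [e, e']
          linarith }
  refine ⟨c, ?_, by exact_mod_cast hK₀⟩
  obtain ⟨F, hF, hFf, hFp⟩ := hfree
  refine c.represents_of_lift hr h α hF (fun t => ?_) (by simpa using hFp 0)
  rw [hFf]
  simp only [c]
  rw [mul_div_cancel_right₀ _ hKpos.ne']

end Geodesics

/-! ### Word length and divisibility -/

section Words

variable {G : Type*} [Group G] {S : Set G}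

theorem wordLength_le_iff {g : G} {k : ℕ} : wordLength S g ≤ k ↔
    ∃ w : List G, (∀ s ∈ w, s ∈ S ∨ s⁻¹ ∈ S) ∧ w.prod = g ∧ w.length ≤ k := by
  constructor
  · intro h
    have h1 : wordLength S g < (k + 1 : ℕ) := h.trans_lt (by exact_mod_cast Nat.lt_succ_self k)
    obtain ⟨w, hw⟩ := iInf_lt_iff.1 h1
    obtain ⟨⟨hw1, hw2⟩, hw3⟩ := iInf_lt_iff.1 hw
    exact ⟨w, hw1, hw2, Nat.lt_succ_iff.1 (by exact_mod_cast hw3)⟩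
  · rintro ⟨w, hw1, hw2, hw3⟩
    exact (iInf₂_le w ⟨hw1, hw2⟩).trans (by exact_mod_cast hw3)

theorem wordLength_one : wordLength S 1 ≤ (0 : ℕ) :=
  wordLength_le_iff.2 ⟨[], by simp⟩

theorem wordLength_mul_le {g h : G} {j k : ℕ} (hg : wordLength S g ≤ j) (hh : wordLength S h ≤ k) :
    wordLength S (g * h) ≤ (j + k : ℕ) := by
  obtain ⟨v, hv1, rfl, hv3⟩ := wordLength_le_iff.1 hg
  obtain ⟨w, hw1, rfl, hw3⟩ := wordLength_le_iff.1 hh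
  refine wordLength_le_iff.2 ⟨v ++ w, fun s hs => ?_, by simp, by simp; omega⟩
  exact (List.mem_append.1 hs).elim (hv1 s) (hw1 s)

theorem exists_wordLength_le (hS : Subgroup.closure S = ⊤) (g : G) :
    ∃ k : ℕ, wordLength S g ≤ k := by
  have hg : g ∈ (Subgroup.closure S).toSubmonoid := hS ▸ Subgroup.mem_top g
  rw [Subgroup.closure_toSubmonoid] at hg
  obtain ⟨w, hw, hg⟩ := Submonoid.exists_list_of_mem_closure hg
  exact ⟨w.length, wordLength_le_iff.2 ⟨w, hw, hg, le_rfl⟩⟩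

/-- A subgroup missing `g h g⁻¹` pulls back under conjugation by `g` to one missing `h`, and cosets
of the pullback inject into those of the original. -/
theorem divisibility_le_of_conj (g h : G) : divisibility h ≤ divisibility (g * h * g⁻¹) := by
  refine le_iInf₂ fun H hH => ?_
  refine (iInf₂_le (H.comap (MulAut.conj g).toMonoidHom) (by simpa using hH)).trans ?_
  have hmap : ∀ a b : G, QuotientGroup.leftRel (H.comap (MulAut.conj g).toMonoidHom) a b ↔
      QuotientGroup.leftRel H (MulAut.conj g a) (MulAut.conj g b) := by
    intro a b
    rw [QuotientGroup.leftRel_apply, QuotientGroup.leftRel_apply, Subgroup.mem_comap]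
    simp [mul_assoc]
  refine ENat.card_le_card_of_injective (f := Quotient.map (MulAut.conj g)
    fun a b hab => (hmap a b).1 hab) ?_
  rintro ⟨a⟩ ⟨b⟩ hab
  exact Quotient.sound ((hmap a b).2 (Quotient.exact hab))

end Words

/-! ### Comparison of word length with chains -/

section Growth

variable {M : Type*} [MetricSpace M] {x₀ : M} {r : ℝ} {hL : LipschitzJoined M}

theorem Path.Homotopic.Quotient.trans_trans_eq_insert {X : Type*} [TopologicalSpace X]
    {x x' y y' z : X} (u : Path.Homotopic.Quotient x y) (v : Path.Homotopic.Quotient x' y)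
    (s : Path.Homotopic.Quotient y y') (t : Path.Homotopic.Quotient y' z) :
    (u.trans s).trans t = (u.trans v.symm).trans (v.trans (s.trans t)) := by
  rw [Path.Homotopic.Quotient.trans_assoc, Path.Homotopic.Quotient.trans_assoc u,
    ← Path.Homotopic.Quotient.trans_assoc v.symm, Path.Homotopic.Quotient.symm_trans,
    Path.Homotopic.Quotient.refl_trans]

/-- The displacement along a chain in the universal cover bounds the word length, up to
conjugation. -/
theorem exists_conj_wordLength_le [CompactSpace M] (hr : SmallPathsHomotopic M r)
    {ρ : ℝ} (hρr : 5 * ρ ≤ r) (hρ : 0 < ρ) (S : Set (FundamentalGroup M x₀))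
    (hS : Subgroup.closure S = ⊤) :
    ∃ C : ℕ, ∀ (m : ℕ) (a : PathCover x₀) (α : FundamentalGroup M x₀),
      Chain hL r ρ m a (deck α.toPath a) →
        ∃ g : FundamentalGroup M x₀, wordLength S (g * α * g⁻¹) ≤ (C * m : ℕ) := by
  obtain ⟨N, -, hNfin, hN⟩ := (isCompact_univ (X := M)).finite_cover_balls hρ
  choose ν hνN hν using fun x => show ∃ z ∈ N, dist x z < ρ by simpa using hN (mem_univ x)
  let w : ∀ z : M, Path.Homotopic.Quotient x₀ z := shortClass hL r x₀
  -- The loop out to one net point, across to another and back; only the finitely many values at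
  -- pairs in `N` matter, so their word lengths have a common bound `C`.
  let T : M × M → FundamentalGroup M x₀ := fun p =>
    (w p.1).trans ((shortClass hL r p.1 p.2).trans (w p.2).symm)
  choose l hl using exists_wordLength_le hS
  obtain ⟨C, hC⟩ := ((hNfin.prod hNfin).image fun p => l (T p)).bddAbove
  have hT : ∀ x ∈ N, ∀ y ∈ N, wordLength S (T (x, y)) ≤ (C : ℕ) := fun x hx y hy =>
    (hl _).trans (by exact_mod_cast hC ⟨(x, y), ⟨hx, hy⟩, rfl⟩)
  -- The path class is closed up to a loop at `x₀` through the nearest chosen net point. One step of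
  -- a chain multiplies `g` on the left by a value of `T`, while a deck transformation multiplies it
  -- on the right.
  let g : PathCover x₀ → FundamentalGroup M x₀ := fun a =>
    (a.2.trans (shortClass hL r a.1 (ν a.1))).trans (w (ν a.1)).symm
  have hg : ∀ a b : PathCover x₀, dist a.1 b.1 < ρ → b = step hL r a b.1 →
      g b = T (ν a.1, ν b.1) * g a := by
    intro a b hab hb
    have ha' := hν a.1
    have hb' := hν b.1
    have h1 := dist_triangle_left (ν a.1) (ν b.1) a.1
    have h2 := dist_triangle a.1 b.1 (ν b.1)
    have e : step hL r b (ν b.1) = step hL r (step hL r a (ν a.1)) (ν b.1) := by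
      rw [step_step hL hr (by linarith)]
      conv_lhs => rw [hb]
      rw [step_fst, step_step hL hr (by linarith)]
    have e2 : b.2.trans (shortClass hL r b.1 (ν b.1)) =
        (a.2.trans (shortClass hL r a.1 (ν a.1))).trans (shortClass hL r (ν a.1) (ν b.1)) :=
      eq_of_heq (Sigma.mk.inj e).2
    rw [FundamentalGroup.mul_def]
    simp only [g, T]
    rw [e2]
    exact Path.Homotopic.Quotient.trans_trans_eq_insert _ _ _ _
  refine ⟨C, fun m a α ⟨y, y0, ym, hy⟩ => ⟨g a, ?_⟩⟩
  have key : ∀ i ≤ m, wordLength S (g (y i) * (g a)⁻¹) ≤ (C * i : ℕ) := by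
    intro i hi
    induction i with
    | zero =>
      rw [y0, mul_inv_cancel]
      exact wordLength_one
    | succ i ih =>
      obtain ⟨h1, h2⟩ := hy i hi
      rw [hg _ _ h1 h2, mul_assoc, mul_add, mul_one, add_comm (C * i)]
      exact wordLength_mul_le (hT _ (hνN _) _ (hνN _)) (ih (Nat.le_of_succ_le hi))
  have hend : g (y m) = g a * α := by
    rw [ym, FundamentalGroup.mul_def]
    simp only [g, deck, Path.Homotopic.Quotient.trans_assoc]
  rw [← hend]
  exact key m le_rfl

/-- Each generator or inverse is reached by a chain from the base point, with `C` the longest of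
these; the chain of the next letter is translated to the endpoint of the previous ones. -/
theorem exists_chain_le_of_wordLength (hr : SmallPathsHomotopic M r) {ρ : ℝ} (h : 0 < r)
    (hρr : ρ ≤ r) (hρ : 0 < ρ) (S : Set (FundamentalGroup M x₀)) (hS : S.Finite) :
    ∃ C : ℕ, ∀ (n : ℕ) (α : FundamentalGroup M x₀), wordLength S α ≤ n →
      ∃ k ≤ C * n, Chain hL r ρ k (base x₀) (deck α.toPath (base x₀)) := by
  choose m hm using fun α : FundamentalGroup M x₀ =>
    exists_chain_deck (hL := hL) hr h hρ hρr α.toPath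
  have hfin : (S ∪ S⁻¹).Finite := hS.union hS.inv
  obtain ⟨C, hC⟩ := (hfin.image m).bddAbove
  refine ⟨C, fun n α hα => ?_⟩
  obtain ⟨w, hw, rfl, hwn⟩ := wordLength_le_iff.1 hα
  suffices ∃ k ≤ C * w.length, Chain hL r ρ k (base x₀) (deck w.prod.toPath (base x₀)) by
    obtain ⟨k, hk, hch⟩ := this
    exact ⟨k, hk.trans (Nat.mul_le_mul_left C hwn), hch⟩
  clear hα hwn
  induction w with
  | nil =>
    refine ⟨0, Nat.zero_le _, ?_⟩
    rw [List.prod_nil, FundamentalGroup.one_def, deck_refl]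
    exact Chain.refl _
  | cons s w ih =>
    obtain ⟨k, hk, hch⟩ := ih fun t ht => hw t (List.mem_cons_of_mem s ht)
    have hs : m s ≤ C := hC ⟨s, hw s List.mem_cons_self, rfl⟩
    refine ⟨k + m s, ?_, ?_⟩
    · rw [List.length_cons, mul_add, mul_one]
      exact add_le_add hk hs
    · rw [List.prod_cons, FundamentalGroup.mul_def, deck_trans]
      exact hch.trans ((hm s).deck _)

end Growth

theorem residualGrowth_growthLE {M : Type*} [MetricSpace M] [CompactSpace M]
    (hL : LipschitzJoined M) {r : ℝ} (hr : SmallPathsHomotopic M r) (h : 0 < r) (x₀ : M)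
    (S : Set (FundamentalGroup M x₀)) (hS : S.Finite) :
    GrowthLE (residualGrowth S) (geodesicResidualGrowth M x₀) := by
  obtain ⟨B, hB⟩ := exists_chain_le_of_wordLength (hL := hL) hr (ρ := r / 5) h (by linarith)
    (by positivity) S hS
  obtain ⟨C, hC⟩ := exists_nat_ge (B * (r / 5))
  -- The summand `1` only makes the constant positive; the comparison takes place in the argument of
  -- the growth function.
  refine ⟨C + 1, Nat.succ_pos C, fun n => iSup₂_le fun α hα => ?_⟩
  obtain ⟨k, hk, hch⟩ := hB n α hα.2
  obtain ⟨c, hc, hlen⟩ := Chain.exists_closedGeodesic (ρ := ⟨r / 5, by positivity⟩) hr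
    (show 5 * (r / 5) ≤ r by linarith) (show (0 : ℝ) < r / 5 by positivity) hα.1 hch
  have hlen' : c.length ≤ ((C + 1) * n : ℕ) := by
    have h1 : (k : ℝ) ≤ B * n := by exact_mod_cast hk
    have h2 : (k : ℝ) * (r / 5) ≤ B * n * (r / 5) := mul_le_mul_of_nonneg_right h1 (by positivity)
    have h3 : B * (r / 5) * n ≤ C * n := mul_le_mul_of_nonneg_right hC (Nat.cast_nonneg n)
    have h4 : c.length ≤ k * (r / 5) := hlen
    push_cast
    linarith [Nat.cast_nonneg (α := ℝ) n]
  have hgl : geodesicLength α ≤ ((C + 1) * n : ℕ) := by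
    refine (iInf₂_le c hc).trans ?_
    rw [← ENNReal.ofReal_natCast]
    exact ENNReal.ofReal_le_ofReal hlen'
  have hdiv : divisibility α ≤ geodesicResidualGrowth M x₀ ((C + 1) * n) :=
    le_iSup₂_of_le α ⟨hα.1, hgl⟩ le_rfl
  exact hdiv.trans (le_mul_of_one_le_left' (by exact_mod_cast Nat.succ_pos C))

theorem geodesicResidualGrowth_growthLE {M : Type*} [MetricSpace M] [CompactSpace M]
    (hL : LipschitzJoined M) {r : ℝ} (hr : SmallPathsHomotopic M r) (h : 0 < r) (x₀ : M)
    (S : Set (FundamentalGroup M x₀)) (hS : Subgroup.closure S = ⊤) :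
    GrowthLE (geodesicResidualGrowth M x₀) (residualGrowth S) := by
  obtain ⟨B, hB⟩ := exists_conj_wordLength_le (hL := hL) hr (ρ := r / 5) (by linarith)
    (by positivity) S hS
  have hone : ∀ (m : ℕ) (α : FundamentalGroup M x₀) (c : ClosedGeodesic M), α ≠ 1 →
      c.Represents α → c.length < m * (r / 5) → divisibility α ≤ residualGrowth S (B * m) := by
    intro m α c hα hc hlen
    obtain ⟨a, hch⟩ := hc.exists_chain (hL := hL) hr h (ρ := r / 5) (by positivity)
      (by linarith) hlen
    obtain ⟨g, hg⟩ := hB m a α hch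
    refine (divisibility_le_of_conj g α).trans (le_iSup₂_of_le (g * α * g⁻¹) ⟨?_, hg⟩ le_rfl)
    rwa [Ne, conj_eq_one_iff]
  have hmono : Monotone (residualGrowth S) := fun i j hij =>
    iSup₂_le fun g hg => le_iSup₂_of_le g ⟨hg.1, hg.2.trans (by exact_mod_cast hij)⟩ le_rfl
  obtain ⟨D, hD⟩ := exists_nat_gt (2 / (r / 5))
  rw [div_lt_iff₀ (by positivity)] at hD
  have hlt : ∀ (α : FundamentalGroup M x₀) (n : ℕ), geodesicLength α ≤ n → ∀ L : ℝ, n < L →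
      ∃ c : ClosedGeodesic M, c.Represents α ∧ c.length < L := by
    -- `geodesicLength` is an infimum that need not be attained, so an actual geodesic is found only
    -- below a strictly larger bound.
    intro α n hn L hL
    have hL0 : 0 < L := (Nat.cast_nonneg n).trans_lt hL
    have h1 : geodesicLength α < ENNReal.ofReal L := hn.trans_lt (by
      rw [← ENNReal.ofReal_natCast]
      exact (ENNReal.ofReal_lt_ofReal_iff hL0).2 hL)
    obtain ⟨c, hc⟩ := iInf_lt_iff.1 h1
    obtain ⟨hc1, hc2⟩ := iInf_lt_iff.1 hc
    exact ⟨c, hc1, (ENNReal.ofReal_lt_ofReal_iff hL0).1 hc2⟩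
  refine ⟨B * D + 1, Nat.succ_pos _, fun n => iSup₂_le fun α hα => ?_⟩
  -- For `n = 0` the rescaled argument is still `0` and leaves no slack; but a class of length `0`
  -- has representatives shorter than `r`, hence is trivial.
  rcases Nat.eq_zero_or_pos n with rfl | hn
  · obtain ⟨c, hc, hlen⟩ := hlt α 0 hα.2 r (by simpa using h)
    exact absurd (hc.eq_one hL hr hlen) hα.1
  · have hn' : (1 : ℝ) ≤ n := by exact_mod_cast hn
    -- For `n ≥ 1` the extra `1` is absorbed by `n + 1 ≤ 2 n`, and `D` was chosen with `2 < D * (r /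
    -- 5)`.
    obtain ⟨c, hc, hlen⟩ := hlt α n hα.2 (n + 1) (by linarith)
    have hlen' : c.length < (D * n : ℕ) * (r / 5) := by
      push_cast
      nlinarith
    refine (hone _ α c hα.1 hc hlen').trans ((hmono ?_).trans
      (le_mul_of_one_le_left' (by exact_mod_cast Nat.succ_pos (B * D))))
    rw [← mul_assoc]
    exact Nat.mul_le_mul_right n (Nat.le_succ _)

end

theorem lemma6p1 (n : ℕ) (M : Type*) [MetricSpace M] [CompactSpace M]
    (hM : IsHyperbolicManifold n M) (x₀ : M)
    (S : Set (FundamentalGroup M x₀)) (hSfin : S.Finite) (hSgen : Subgroup.closure S = ⊤) :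
    GrowthEquiv (residualGrowth S) (geodesicResidualGrowth M x₀) := by
  obtain ⟨r, h, hr⟩ := hM.exists_smallPathsHomotopic
  exact ⟨residualGrowth_growthLE hM.lipschitzJoined hr h x₀ S hSfin,
    geodesicResidualGrowth_growthLE hM.lipschitzJoined hr h x₀ S hSgen⟩
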